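/- Let $\ell\ge 2$ be an even integer, $c_1\in\mathbb R$, and $f(x)=x^{\ell}+c_1$ on $\mathbb R$, with critical point $c=0$ and critical value $c_1$. For a real number $u\neq 0$ let $V=[-|u|,|u|]$. Say that $V$ is a periodic interval of period $s\ge 2$ with periodic endpoint $u$ if $f^s(u)=u$, $f^s(V)\subseteq V$, and $f^i(V)\cap \operatorname{int}V=\emptyset$ for $0<i<s$; say that $f$ is renormalizable of period $s$ if such a $u$ exists, and infinitely renormalizable if it is renormalizable of arbitrarily large periods. There are universal constants $C_0,C_1,C_2>0$ with the following property. Let $\ell$ and $c_1$ be such that $f$ is infinitely renormalizable, let $V$ be a periodic interval of period $s$ with periodic endpoint $u$, and assume that $f$ is not renormalizable of period $s/2$ (no condition if $s$ is odd). Let $T_1\supseteq f(V)$ be the maximal interval on which $f^{s-1}$ is monotone, and let $T$ be the component of $f^{-1}(T_1)\setminus\{c\}$ that contains $u$. Then: 1. $V$ is contained in the interior of $f^{s-1}(T_1)$, and each component of $f^{s-1}(T_1)\setminus V$ has length at least $\frac{C_0}{\ell}|u-c|$. 2. There exists $\tilde u\in T$ such that $$\frac{C_1/2}{\ell}|u-c|\le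 |f^s(\tilde u)-u|\le \frac{C_1}{\ell}|u-c|\qquad\text{and}\qquad |f^s(\tilde u)-c|\ge \Bigl(1+\frac{C_2}{\ell^2}\Bigr)|\tilde u-c|,$$ and, if $\ell\ge 4$, there exists moreover $u_*\in T_1$ such that $$f^{s-1}(u_*)=-f^s(\tilde u)\qquad\text{and}\qquad |u_*-c_1|<|f(u)-c_1|.$$ -/

import Mathlib

open Set

namespace RealUnicritical

/-- The real map `x ↦ x ^ ℓ + c₁`. For even `ℓ` it is unimodal, its critical point is `c = 0`
and its critical value is `c₁`. -/
def powMap (ℓ : ℕ) (c₁ : ℝ) (x : ℝ) : ℝ := x ^ ℓ + c₁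

/-- The compact interval with endpoints `u` and `-u`, symmetric around the critical point `0`
(the sign of `u` is arbitrary). -/
def symInterval (u : ℝ) : Set ℝ := Icc (-|u|) |u|

/-- `V = [-|u|, |u|]` is a periodic (renormalization) interval of period `s` for `f`, and `u` is
the endpoint of `V` that is fixed by `f^s`. The interior of `V` does not meet
`f(V), …, f^(s-1)(V)` and `f^s` maps `V` into itself: the first return map to `V` is `f^s`, on
all of `V`. -/
structure IsPeriodicInterval (f : ℝ → ℝ) (s : ℕ) (u : ℝ) : Prop where
  two_le : 2 ≤ s
  ne_zero : u ≠ 0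
  fixed : f^[s] u = u
  mapsTo : MapsTo f^[s] (symInterval u) (symInterval u)
  disjoint : ∀ i, 0 < i → i < s → Disjoint (f^[i] '' symInterval u) (interior (symInterval u))

/-- `f` is renormalizable of period `s` (a period is at least `2`). -/
def Renormalizable (f : ℝ → ℝ) (s : ℕ) : Prop := ∃ u, IsPeriodicInterval f s u

/-- `f` is renormalizable of arbitrarily large periods. -/
def InfinitelyRenormalizable (f : ℝ → ℝ) : Prop := ∀ N : ℕ, ∃ s, N ≤ s ∧ Renormalizable f s

/-- `T₁` is an interval that contains `A` and on which `g` is monotone (increasing or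
decreasing). -/
def IsMonotoneIntervalAround (g : ℝ → ℝ) (A T₁ : Set ℝ) : Prop :=
  T₁.OrdConnected ∧ A ⊆ T₁ ∧ (MonotoneOn g T₁ ∨ AntitoneOn g T₁)

/-- `T₁` is the maximal interval that contains `A` and on which `g` is monotone. -/
def IsMaximalMonotoneInterval (g : ℝ → ℝ) (A T₁ : Set ℝ) : Prop :=
  Maximal (IsMonotoneIntervalAround g A) T₁

/-- The component of `f⁻¹(T₁) \ {c}`, `c = 0`, that contains `u`. -/
def sideComponent (f : ℝ → ℝ) (T₁ : Set ℝ) (u : ℝ) : Set ℝ :=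
  connectedComponentIn (f ⁻¹' T₁ \ {0}) u

end RealUnicritical

/-!
Rescale so that the periodic end point `u` is at `1` and write the first return map to `V` as `x ↦
φ (x ^ l)`, where `φ` (`branch`) is `f^(s-1)` near the critical value `c₁`; then `φ 1 = 1` and `φ
0 = -p`. Everything is derived from the expansion of cross-ratios: powers expand them on the
half-line (`crossRatio_le_crossRatio_pow`), hence `φ` expands them on its interval of
monotonicity.

*Space.* Consider the intervals `f(V), …, f^s(V)`, or more generally the images of a slightly
larger interval around `c₁` (`IsTubeCycle`). The shortest of them has on each side an interval of
the cycle that is at least as long, or only points far away, so that the cross-ratio of the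
quadruple formed by it and the far ends of its neighbours is at most `3`. Follow the first
interval, together with `f^(i+1)(V)` on its right, up to the time of the shortest one. Whenever an
outer point of the quadruple falls on the other side of the critical point, it is reset to a point
beyond the critical value, and the cross-ratio still does not decrease (`crossRatio_jump`). The
comparison shows that each image `f^i(V)`, `0 < i < s`, reaches at least as far as `(4 / 3) ^ (1 /
l) |u|` from the critical point (`IsTubeCycle.exists_end_le`). The maximal interval of
monotonicity of `f^(s-1)` is unbounded on the left or ends at turning points, and near such an end
its image contains some `f^i(V)` between `V` and the image of the turning point; so `φ` takes
values beyond `±D` with `D = (4 / 3) ^ (1 / l) ≥ 1 + 1 / (4 l)`. This is the first claim.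

*Expansion.* The critical orbit of an infinitely renormalizable map cannot converge to a periodic
orbit (`not_tendsto_of_infinitelyRenormalizable`), so no interval that meets it is mapped
monotonically into itself by a multiple of the return map. Hence `0 < p`, `0 ≤ φ (p ^ l)` and `x <
φ (x ^ l)` for `1 < x` (`lt_branch_pow`). Therefore `φ z = D` for some `z ≤ 4 / 3`, and the
expansion of the cross-ratio of `0, 1, y, z`, where `φ y = 1 + 1 / (1000 l)`, bounds `y = v ^ l`
from above (`BranchBounds.exists_expanding`).

*Asymmetry for `l ≥ 4`.* Suppose that the point where `φ` equals `-(1 + 1 / (1000 l))` is at least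
as far from `0` as `1`. Then some interval `[-t, 1]` with `φ (-t) ≤ -t ^ l` generates a cycle to
which the space argument applies. It gives a point `-A` with `A ^ l ≥ (4 + t) / 3` such that the
cross-ratio of `-∞, -t, 0, p ^ l` is at most that of `-A, φ (-t), -p, φ (p ^ l)`
(`IsDeepPeriodicInterval.exists_space`). As `l t ^ (l - 1) (1 - t) ≤ 27 / 64` on `[0, 1]` for `l ≥
4`, this is impossible (`IsDeepPeriodicInterval.neg_one_lt_of_branch_eq`).
-/

namespace RealUnicritical

/-! ### Cross-ratios -/

/-- The cross-ratio `|J| |T| / (|L| |R|)` of four points in monotone order, where `J` is the middle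
interval, `T` the whole one and `L`, `R` are the two lateral ones. Written without absolute values
it does not depend on whether the points are listed in increasing or in decreasing order. -/
noncomputable def crossRatio (a b c d : ℝ) : ℝ := (c - b) * (d - a) / ((b - a) * (d - c))

/-- The four points are in strictly monotone order, increasing or decreasing. -/
def InOrder (a b c d : ℝ) : Prop := (a < b ∧ b < c ∧ c < d) ∨ (d < c ∧ c < b ∧ b < a)

lemma crossRatio_reverse (a b c d : ℝ) : crossRatio d c b a = crossRatio a b c d := by
  unfold crossRatio
  congr 1 <;> ring

lemma crossRatio_neg (a b c d : ℝ) : crossRatio (-a) (-b) (-c) (-d) = crossRatio a b c d := by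
  unfold crossRatio
  congr 1 <;> ring

lemma crossRatio_affine {r : ℝ} (hr : r ≠ 0) (t a b c d : ℝ) :
    crossRatio (t + a * r) (t + b * r) (t + c * r) (t + d * r) = crossRatio a b c d := by
  unfold crossRatio
  rw [show (t + c * r - (t + b * r)) * (t + d * r - (t + a * r)) = ((c - b) * (d - a)) * r ^ 2 by
      ring, show (t + b * r - (t + a * r)) * (t + d * r - (t + c * r)) =
      ((b - a) * (d - c)) * r ^ 2 by ring]
  exact mul_div_mul_right _ _ (pow_ne_zero 2 hr)

lemma crossRatio_div {r : ℝ} (hr : r ≠ 0) (a b c d : ℝ) :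
    crossRatio (a / r) (b / r) (c / r) (d / r) = crossRatio a b c d := by
  have := crossRatio_affine (inv_ne_zero hr) 0 a b c d
  simpa [div_eq_mul_inv] using this

/-- The cross-ratio decreases when the left outer point moves to `-∞`. -/
lemma div_le_crossRatio {a b c d : ℝ} (hab : a < b) (hbc : b < c) (hcd : c < d) :
    (c - b) / (d - c) ≤ crossRatio a b c d := by
  unfold crossRatio
  rw [div_le_div_iff₀ (by linarith) (mul_pos (by linarith) (by linarith))]
  have : 0 ≤ (c - b) * (d - c) := mul_nonneg (by linarith) (by linarith)
  nlinarith

/-- If both lateral intervals are at least as long as the middle one, the cross-ratio is at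
most `3`. -/
lemma crossRatio_le_three {a b c d : ℝ} (h : InOrder a b c d) (hl : |c - b| ≤ |a - b|)
    (hr : |c - b| ≤ |d - c|) : crossRatio a b c d ≤ 3 := by
  have key : ∀ {a b c d : ℝ}, a < b → b < c → c < d → c - b ≤ b - a → c - b ≤ d - c →
      crossRatio a b c d ≤ 3 := by
    intro a b c d h1 h2 h3 hl hr
    unfold crossRatio
    rw [div_le_iff₀ (mul_pos (by linarith) (by linarith))]
    nlinarith [mul_nonneg (sub_nonneg.2 hl) (sub_nonneg.2 h3.le),
      mul_nonneg (sub_nonneg.2 hr) (sub_nonneg.2 h1.le),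
      mul_nonneg (sub_nonneg.2 hr) (sub_nonneg.2 h2.le)]
  rcases h with ⟨h1, h2, h3⟩ | ⟨h1, h2, h3⟩
  · rw [abs_of_pos (by linarith), abs_of_neg (by linarith)] at hl
    rw [abs_of_pos (by linarith), abs_of_pos (by linarith)] at hr
    exact key h1 h2 h3 (by linarith) (by linarith)
  · rw [abs_of_neg (by linarith), abs_of_pos (by linarith)] at hl
    rw [abs_of_neg (by linarith), abs_of_neg (by linarith)] at hr
    rw [← crossRatio_reverse]
    exact key h1 h2 h3 (by linarith) (by linarith)

lemma pow_mul_pow_swap_le {x y : ℝ} (hy : 0 ≤ y) (hxy : y ≤ x) {i j : ℕ} (hij : j ≤ i) :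
    x ^ j * y ^ i ≤ x ^ i * y ^ j := by
  obtain ⟨k, rfl⟩ := Nat.exists_eq_add_of_le hij
  have h1 : y ^ k ≤ x ^ k := pow_le_pow_left₀ hy hxy k
  have h2 : 0 ≤ x ^ j * y ^ j := mul_nonneg (pow_nonneg (hy.trans hxy) j) (pow_nonneg hy j)
  calc x ^ j * y ^ (j + k) = x ^ j * y ^ j * y ^ k := by ring
    _ ≤ x ^ j * y ^ j * x ^ k := mul_le_mul_of_nonneg_left h1 h2
    _ = x ^ (j + k) * y ^ j := by ring

/-- The kernel `(x, a) ↦ (x ^ n - a ^ n) / (x - a) = ∑ x ^ i a ^ (n - 1 - i)` is totally negative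
of order two. -/
lemma geomSum_mul_geomSum_le (n : ℕ) {x y a c : ℝ} (ha : 0 ≤ a) (hac : a ≤ c) (hy : 0 ≤ y)
    (hyx : y ≤ x) :
    (∑ i ∈ Finset.range n, x ^ i * c ^ (n - 1 - i)) *
      (∑ i ∈ Finset.range n, y ^ i * a ^ (n - 1 - i)) ≤
    (∑ i ∈ Finset.range n, x ^ i * a ^ (n - 1 - i)) *
      (∑ i ∈ Finset.range n, y ^ i * c ^ (n - 1 - i)) := by
  set t : ℕ → ℕ → ℝ := fun i j =>
    x ^ i * a ^ (n - 1 - i) * (y ^ j * c ^ (n - 1 - j)) -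
      x ^ i * c ^ (n - 1 - i) * (y ^ j * a ^ (n - 1 - j)) with ht
  have h1 : (∑ i ∈ Finset.range n, x ^ i * a ^ (n - 1 - i)) *
      (∑ i ∈ Finset.range n, y ^ i * c ^ (n - 1 - i)) -
      (∑ i ∈ Finset.range n, x ^ i * c ^ (n - 1 - i)) *
      (∑ i ∈ Finset.range n, y ^ i * a ^ (n - 1 - i)) =
      ∑ i ∈ Finset.range n, ∑ j ∈ Finset.range n, t i j := by
    simp only [ht, Finset.sum_mul_sum, Finset.sum_sub_distrib]
  have h2 : ∑ i ∈ Finset.range n, ∑ j ∈ Finset.range n, t i j =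
      ∑ i ∈ Finset.range n, ∑ j ∈ Finset.range n, t j i := Finset.sum_comm
  have h3 : 0 ≤ ∑ i ∈ Finset.range n, ∑ j ∈ Finset.range n, (t i j + t j i) := by
    refine Finset.sum_nonneg fun i hi => Finset.sum_nonneg fun j hj => ?_
    rw [Finset.mem_range] at hi hj
    have e : t i j + t j i = (x ^ i * y ^ j - x ^ j * y ^ i) *
        (c ^ (n - 1 - j) * a ^ (n - 1 - i) - c ^ (n - 1 - i) * a ^ (n - 1 - j)) := by
      simp only [ht]; ring
    rw [e]
    rcases le_total j i with h | h
    · exact mul_nonneg (sub_nonneg.2 (pow_mul_pow_swap_le hy hyx h))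
        (sub_nonneg.2 (pow_mul_pow_swap_le ha hac (by omega)))
    · exact mul_nonneg_of_nonpos_of_nonpos (sub_nonpos.2 (pow_mul_pow_swap_le hy hyx h))
        (sub_nonpos.2 (pow_mul_pow_swap_le ha hac (by omega)))
  simp only [Finset.sum_add_distrib] at h3
  linarith

/-- Powers expand cross-ratios on the positive half-line. -/
lemma crossRatio_le_crossRatio_pow {n : ℕ} (hn : n ≠ 0) {a b c d : ℝ} (ha : 0 ≤ a) (hab : a < b)
    (hbc : b < c) (hcd : c < d) :
    crossRatio a b c d ≤ crossRatio (a ^ n) (b ^ n) (c ^ n) (d ^ n) := by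
  have pab : a ^ n < b ^ n := pow_lt_pow_left₀ hab ha hn
  have pcd : c ^ n < d ^ n := pow_lt_pow_left₀ hcd (by linarith) hn
  have key := geomSum_mul_geomSum_le n ha (hab.trans hbc).le (ha.trans hab.le) (hbc.trans hcd).le
  have e1 := geom_sum₂_mul b a n
  have e2 := geom_sum₂_mul d c n
  have e3 := geom_sum₂_mul b c n
  have e4 := geom_sum₂_mul d a n
  unfold crossRatio
  rw [div_le_div_iff₀ (mul_pos (by linarith) (by linarith)) (mul_pos (by linarith) (by linarith)),
    ← e1, ← e2, ← e4, show c ^ n - b ^ n = -(b ^ n - c ^ n) by ring, ← e3]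
  have hpos : 0 ≤ (c - b) * (d - a) * ((b - a) * (d - c)) := by
    have := sub_pos.2 hab; have := sub_pos.2 hbc; have := sub_pos.2 hcd
    have : 0 < d - a := by linarith
    positivity
  have := mul_le_mul_of_nonneg_left key hpos
  nlinarith

/-! ### The jump inequality -/

lemma pow_sub_pow_le_of_le_one {l : ℕ} (hl : 2 ≤ l) {t : ℝ} (h0 : 0 ≤ t) (h1 : t ≤ 1) :
    ((l : ℝ) + 1) * (t - t ^ l) ≤ ((l : ℝ) - 1) * (1 - t ^ (l + 1)) := by
  -- After division by `1 - t` this says `∑ (1 - t ^ i) (1 - t ^ (l - i)) ≥ 0`, `0 < i < l`.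
  obtain ⟨m, rfl⟩ : ∃ m, l = m + 2 := ⟨l - 2, by omega⟩
  have hs : ∑ i ∈ Finset.range (m + 1), (1 - t ^ (i + 1)) * (1 - t ^ (m + 1 - i)) =
      ((m : ℝ) + 1) * (1 + t ^ (m + 2)) - 2 * (t * ∑ i ∈ Finset.range (m + 1), t ^ i) := by
    have e1 : ∑ i ∈ Finset.range (m + 1), t ^ (m + 1 - i) =
        ∑ i ∈ Finset.range (m + 1), t ^ (i + 1) := by
      rw [← Finset.sum_range_reflect]
      refine Finset.sum_congr rfl fun i hi => ?_
      rw [Finset.mem_range] at hi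
      congr 1; omega
    have e2 : ∑ i ∈ Finset.range (m + 1), t ^ (i + 1) =
        t * ∑ i ∈ Finset.range (m + 1), t ^ i := by
      rw [Finset.mul_sum]; exact Finset.sum_congr rfl fun i _ => by ring
    have e3 : ∀ i ∈ Finset.range (m + 1), (1 - t ^ (i + 1)) * (1 - t ^ (m + 1 - i)) =
        (1 + t ^ (m + 2)) - t ^ (i + 1) - t ^ (m + 1 - i) := by
      intro i hi
      rw [Finset.mem_range] at hi
      rw [show m + 2 = (i + 1) + (m + 1 - i) by omega, pow_add]; ring
    rw [Finset.sum_congr rfl e3, Finset.sum_sub_distrib, Finset.sum_sub_distrib, e1, e2,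
      Finset.sum_const, Finset.card_range]
    simp only [nsmul_eq_mul]; push_cast; ring
  have hpos : 0 ≤ ∑ i ∈ Finset.range (m + 1), (1 - t ^ (i + 1)) * (1 - t ^ (m + 1 - i)) :=
    Finset.sum_nonneg fun i _ => mul_nonneg (sub_nonneg.2 (pow_le_one₀ h0 h1))
      (sub_nonneg.2 (pow_le_one₀ h0 h1))
  have hg := mul_neg_geom_sum t (m + 1)
  rw [hs] at hpos
  set S := ∑ i ∈ Finset.range (m + 1), t ^ i with hS
  have h1t : 0 ≤ 1 - t := sub_nonneg.2 h1
  have hprod := mul_nonneg hpos h1t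
  have e : t ^ (m + 1) = 1 - (1 - t) * S := by linarith
  push_cast
  have e2 : t ^ (m + 2) = t * (1 - (1 - t) * S) := by rw [pow_succ, e]; ring
  have e3 : t ^ (m + 2 + 1) = t * (t * (1 - (1 - t) * S)) := by rw [pow_succ, e2]; ring
  rw [e2] at hprod
  rw [e2, e3]
  nlinarith

/-- The sign of the derivative of `y ^ (l - 1) * (y + t ^ l) ^ 2 / (y ^ l + t) ^ 2`. -/
lemma jump_deriv_nonpos {l : ℕ} (hl : 2 ≤ l) {t y : ℝ} (h0 : 0 ≤ t) (h1 : t ≤ 1) (hy : 1 ≤ y) :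
    ((l : ℝ) + 1) * (y * t - (y * t) ^ l) ≤ ((l : ℝ) - 1) * (y ^ (l + 1) - t ^ (l + 1)) := by
  have hl' : (2 : ℝ) ≤ l := by exact_mod_cast hl
  rcases le_total (y * t) 1 with h | h
  · have hP : 0 ≤ y * t := by positivity
    refine (pow_sub_pow_le_of_le_one hl hP h).trans
      (mul_le_mul_of_nonneg_left ?_ (by linarith))
    have a1 : 1 ≤ y ^ (l + 1) := one_le_pow₀ hy
    have a2 : 0 ≤ t ^ (l + 1) := pow_nonneg h0 _
    rw [mul_pow]
    have a3 : t ^ (l + 1) ≤ 1 := pow_le_one₀ h0 h1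
    nlinarith
  · have : y * t ≤ (y * t) ^ l := le_self_pow₀ h (by omega)
    have b1 : t ^ (l + 1) ≤ 1 := pow_le_one₀ h0 h1
    have b2 : 1 ≤ y ^ (l + 1) := one_le_pow₀ hy
    have c1 : ((l : ℝ) + 1) * (y * t - (y * t) ^ l) ≤ 0 :=
      mul_nonpos_of_nonneg_of_nonpos (by linarith) (by linarith)
    have c2 : 0 ≤ ((l : ℝ) - 1) * (y ^ (l + 1) - t ^ (l + 1)) :=
      mul_nonneg (by linarith) (by linarith)
    linarith

lemma jump_ratio_antitone {l : ℕ} (hl : 2 ≤ l) {t : ℝ} (h0 : 0 ≤ t) (h1 : t ≤ 1) :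
    AntitoneOn (fun y : ℝ => y ^ (l - 1) * (y + t ^ l) ^ 2 / (y ^ l + t) ^ 2) (Ici 1) := by
  have hpos : ∀ y : ℝ, 1 ≤ y → 0 < y ^ l + t := fun y hy => by positivity
  refine antitoneOn_of_deriv_nonpos (convex_Ici 1) ?_ ?_ ?_
  · refine ContinuousOn.div (by fun_prop) (by fun_prop) fun y hy => ?_
    exact (pow_pos (hpos y hy) 2).ne'
  · intro y hy
    rw [interior_Ici] at hy
    refine (DifferentiableAt.div (by fun_prop) (by fun_prop) ?_).differentiableWithinAt
    exact (pow_pos (hpos y (le_of_lt hy)) 2).ne'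
  · intro y hy
    rw [interior_Ici] at hy
    have hy1 : (1 : ℝ) ≤ y := le_of_lt hy
    have hp := hpos y hy1
    obtain ⟨m, rfl⟩ : ∃ m, l = m + 2 := ⟨l - 2, by omega⟩
    have hd := (((hasDerivAt_pow (m + 1) y).mul
      (((hasDerivAt_id y).add_const (t ^ (m + 2))).pow 2)).div
      (((hasDerivAt_pow (m + 2) y).add_const t).pow 2) (pow_pos hp 2).ne')
    have key := jump_deriv_nonpos hl h0 h1 hy1
    have hd' := hd.deriv
    simp only [Pi.mul_apply, Pi.pow_apply, id] at hd'
    have hfun : (fun y : ℝ => y ^ (m + 2 - 1) * (y + t ^ (m + 2)) ^ 2 / (y ^ (m + 2) + t) ^ 2) =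
      ((((fun x : ℝ => x ^ (m + 1)) * (fun x : ℝ => x + t ^ (m + 2)) ^ 2)) /
        ((fun x : ℝ => x ^ (m + 2) + t) ^ 2)) := by
      ext x; simp
    rw [hfun, hd']
    apply div_nonpos_of_nonpos_of_nonneg _ (by positivity)
    have e : ∀ A : ℝ, A = (y ^ m * (y + t ^ (m + 2)) * (y ^ (m + 2) + t)) *
        (((m + 2 : ℕ) + 1 : ℝ) * (y * t - (y * t) ^ (m + 2)) -
        ((m + 2 : ℕ) - 1 : ℝ) * (y ^ (m + 2 + 1) - t ^ (m + 2 + 1))) → A ≤ 0 := by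
      rintro A rfl
      exact mul_nonpos_of_nonneg_of_nonpos (by positivity) (by linarith)
    apply e
    push_cast
    rw [mul_pow]
    ring

/-- The left limit of a quadruple may jump over the critical point: if the other points lie at
distance at least `1` from the critical point and the left limit `-x` on the other side satisfies
`x ≥ t ^ l`, then after applying `y ↦ y ^ l` the image of the left limit can be replaced by `-t`,
beyond the critical value, without decreasing the cross-ratio. -/
lemma crossRatio_jump {l : ℕ} (hl : 2 ≤ l) {t x e v z : ℝ} (h0 : 0 ≤ t) (h1 : t ≤ 1)
    (hx : t ^ l ≤ x) (he : 1 ≤ e) (hev : e < v) (hvz : v < z) :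
    crossRatio (-x) e v z ≤ crossRatio (-t) (e ^ l) (v ^ l) (z ^ l) := by
  have hτ : 0 ≤ t ^ l := pow_nonneg h0 l
  have hmono : crossRatio (-x) e v z ≤ crossRatio (-(t ^ l)) e v z := by
    unfold crossRatio
    rw [div_le_div_iff₀ (mul_pos (by linarith) (by linarith))
      (mul_pos (by linarith) (by linarith))]
    have : 0 ≤ (v - e) * (z - v) * ((z - e) * (x - t ^ l)) := by
      have := sub_pos.2 hev; have := sub_pos.2 hvz
      exact mul_nonneg (mul_nonneg (by linarith) (by linarith))
        (mul_nonneg (by linarith) (by linarith))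
    nlinarith
  refine hmono.trans ?_
  set A : ℝ → ℝ := fun y => -(y + t ^ l)⁻¹ with hA
  set B : ℝ → ℝ := fun y => -(y ^ l + t)⁻¹ with hB
  have pA : ∀ y : ℝ, 1 ≤ y → 0 < y + t ^ l := fun y hy => by linarith
  have pB : ∀ y : ℝ, 1 ≤ y → 0 < y ^ l + t := fun y hy => by positivity
  have dA : ∀ y : ℝ, 1 ≤ y → HasDerivAt A (1 / (y + t ^ l) ^ 2) y := by
    intro y hy
    have := (((hasDerivAt_id y).add_const (t ^ l)).inv (pA y hy).ne').neg
    rw [neg_div, neg_neg] at this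
    exact this
  have dB : ∀ y : ℝ, 1 ≤ y → HasDerivAt B ((l : ℝ) * y ^ (l - 1) / (y ^ l + t) ^ 2) y := by
    intro y hy
    have := (((hasDerivAt_pow l y).add_const t).inv (pB y hy).ne').neg
    rw [neg_div, neg_neg] at this
    exact this
  have mvt : ∀ p q : ℝ, 1 ≤ p → p < q → ∃ ξ ∈ Ioo p q, B q - B p = (A q - A p) *
      ((l : ℝ) * (ξ ^ (l - 1) * (ξ + t ^ l) ^ 2 / (ξ ^ l + t) ^ 2)) := by
    intro p q hp hpq
    obtain ⟨ξ, hξ, h⟩ := exists_ratio_hasDerivAt_eq_ratio_slope A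
      (fun y => 1 / (y + t ^ l) ^ 2) hpq
      (fun y hy => (dA y (hp.trans hy.1)).continuousAt.continuousWithinAt)
      (fun y hy => dA y (hp.trans hy.1.le)) B
      (fun y => (l : ℝ) * y ^ (l - 1) / (y ^ l + t) ^ 2)
      (fun y hy => (dB y (hp.trans hy.1)).continuousAt.continuousWithinAt)
      (fun y hy => dB y (hp.trans hy.1.le))
    refine ⟨ξ, hξ, ?_⟩
    have k1 := pA ξ (hp.trans hξ.1.le)
    have k2 := pB ξ (hp.trans hξ.1.le)
    rw [mul_one_div, div_eq_iff (pow_pos k1 2).ne'] at h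
    rw [h]
    ring
  obtain ⟨ξ₁, hξ₁, E1⟩ := mvt e v he hev
  obtain ⟨ξ₂, hξ₂, E2⟩ := mvt v z (he.trans hev.le) hvz
  have hQ := jump_ratio_antitone hl h0 h1 (show (1 : ℝ) ≤ ξ₁ from he.trans hξ₁.1.le)
    (show (1 : ℝ) ≤ ξ₂ from (he.trans hev.le).trans hξ₂.1.le) (hξ₁.2.trans hξ₂.1).le
  simp only at hQ
  set Q₁ := ξ₁ ^ (l - 1) * (ξ₁ + t ^ l) ^ 2 / (ξ₁ ^ l + t) ^ 2
  set Q₂ := ξ₂ ^ (l - 1) * (ξ₂ + t ^ l) ^ 2 / (ξ₂ ^ l + t) ^ 2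
  have qe := pA e he
  have qv := pA v (he.trans hev.le)
  have qz := pA z ((he.trans hev.le).trans hvz.le)
  have re := pB e he
  have rv := pB v (he.trans hev.le)
  have rz := pB z ((he.trans hev.le).trans hvz.le)
  have pev : e ^ l < v ^ l := pow_lt_pow_left₀ hev (by linarith) (by omega)
  have pvz : v ^ l < z ^ l := pow_lt_pow_left₀ hvz (by linarith) (by omega)
  have hAe : 0 < A v - A e := by
    simp only [hA]
    have := inv_strictAnti₀ qe (show e + t ^ l < v + t ^ l by linarith)
    linarith
  have hAz : 0 < A z - A v := by
    simp only [hA]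
    have := inv_strictAnti₀ qv (show v + t ^ l < z + t ^ l by linarith)
    linarith
  have main : (A v - A e) * (B z - B v) ≤ (B v - B e) * (A z - A v) := by
    rw [E1, E2]
    have : 0 ≤ (A v - A e) * (A z - A v) * l := by positivity
    nlinarith [mul_le_mul_of_nonneg_left hQ this]
  have f1 : A v - A e = (v - e) / ((e + t ^ l) * (v + t ^ l)) := by
    simp only [hA]; field_simp; ring
  have f2 : A z - A v = (z - v) / ((v + t ^ l) * (z + t ^ l)) := by
    simp only [hA]; field_simp; ring
  have f3 : B v - B e = (v ^ l - e ^ l) / ((e ^ l + t) * (v ^ l + t)) := by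
    simp only [hB]; field_simp; ring
  have f4 : B z - B v = (z ^ l - v ^ l) / ((v ^ l + t) * (z ^ l + t)) := by
    simp only [hB]; field_simp; ring
  rw [f1, f2, f3, f4, div_mul_div_comm, div_mul_div_comm,
    div_le_div_iff₀ (by positivity) (by positivity)] at main
  unfold crossRatio
  rw [div_le_div_iff₀ (mul_pos (by linarith) (by linarith)) (mul_pos (by linarith) (by linarith))]
  have hk : 0 < (v + t ^ l) * (v ^ l + t) := by positivity
  refine le_of_mul_le_mul_left ?_ hk
  nlinarith [main]

/-! ### Iterates of the unicritical map -/

variable {l : ℕ} {c₁ : ℝ}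

lemma continuous_powMap_iterate (n : ℕ) : Continuous ((powMap l c₁)^[n]) :=
  Continuous.iterate (by unfold powMap; fun_prop) n

lemma powMap_neg (he : Even l) (x : ℝ) : powMap l c₁ (-x) = powMap l c₁ x := by
  simp [powMap, he.neg_pow]

lemma powMap_abs (he : Even l) (x : ℝ) : powMap l c₁ |x| = powMap l c₁ x := by
  simp [powMap, he.pow_abs]

lemma powMap_strictMonoOn (hl : l ≠ 0) : StrictMonoOn (powMap l c₁) (Ici 0) := by
  intro x hx y _ hxy
  simpa [powMap] using pow_lt_pow_left₀ hxy hx hl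

lemma powMap_strictAntiOn (hl : l ≠ 0) (he : Even l) : StrictAntiOn (powMap l c₁) (Iic 0) := by
  intro x hx y hy hxy
  rw [mem_Iic] at hx hy
  rw [← powMap_neg he x, ← powMap_neg he y]
  exact powMap_strictMonoOn hl (by simpa using hy) (by simpa using hx) (by linarith)

lemma mul_nonneg_of_mem_uIcc {p q x y : ℝ} (hpq : 0 ≤ p * q) (hx : x ∈ uIcc p q)
    (hy : y ∈ uIcc p q) : 0 ≤ x * y := by
  rcases mul_nonneg_iff.1 hpq with ⟨hp, hq⟩ | ⟨hp, hq⟩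
  · exact mul_nonneg ((le_inf hp hq).trans hx.1) ((le_inf hp hq).trans hy.1)
  · exact mul_nonneg_of_nonpos_of_nonpos (hx.2.trans (sup_le hp hq)) (hy.2.trans (sup_le hp hq))

lemma powMap_mem_uIcc (hl : l ≠ 0) (he : Even l) {p q x : ℝ} (hpq : 0 ≤ p * q)
    (hx : x ∈ uIcc p q) : powMap l c₁ x ∈ uIcc (powMap l c₁ p) (powMap l c₁ q) := by
  have hmono : MonotoneOn (powMap l c₁) (Ici 0) := (powMap_strictMonoOn hl).monotoneOn
  have hanti : AntitoneOn (powMap l c₁) (Iic 0) := (powMap_strictAntiOn hl he).antitoneOn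
  rcases mul_nonneg_iff.1 hpq with ⟨hp, hq⟩ | ⟨hp, hq⟩
  · exact (hmono.mono fun y hy => (le_inf hp hq).trans hy.1).mapsTo_uIcc hx
  · exact (hanti.mono fun y hy => hy.2.trans (sup_le hp hq)).mapsTo_uIcc hx

lemma powMap_injective_of_mul_nonneg (hl : l ≠ 0) (he : Even l) {x y : ℝ} (hxy : 0 ≤ x * y)
    (h : powMap l c₁ x = powMap l c₁ y) : x = y := by
  rcases mul_nonneg_iff.1 hxy with ⟨hx, hy⟩ | ⟨hx, hy⟩
  · exact (powMap_strictMonoOn hl).injOn hx hy h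
  · exact (powMap_strictAntiOn hl he).injOn hx hy h

lemma exists_escape_radius (hl : 2 ≤ l) (he : Even l) (c₁ B : ℝ) :
    ∃ M, B ≤ M ∧ ∀ x, M ≤ |x| → M ≤ |powMap l c₁ x| := by
  refine ⟨max B (2 + |c₁|), le_max_left _ _, fun x hx => ?_⟩
  have h1 : 2 + |c₁| ≤ |x| := (le_max_right _ _).trans hx
  have h2 : |x| ^ 2 ≤ |x| ^ l := pow_le_pow_right₀ (by linarith [abs_nonneg c₁]) hl
  have h3 := neg_abs_le c₁
  have h4 : powMap l c₁ x = |x| ^ l + c₁ := by simp [powMap, he.pow_abs]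
  refine hx.trans (le_trans ?_ (le_abs_self _))
  nlinarith [abs_nonneg c₁]

lemma crossRatio_powMap_le {a b c d : ℝ} (hl : l ≠ 0) (ha : 0 ≤ a) (hab : a < b) (hbc : b < c)
    (hcd : c < d) :
    crossRatio a b c d ≤
      crossRatio (powMap l c₁ a) (powMap l c₁ b) (powMap l c₁ c) (powMap l c₁ d) := by
  have := crossRatio_affine one_ne_zero c₁ (a ^ l) (b ^ l) (c ^ l) (d ^ l)
  simp only [mul_one] at this
  simp only [powMap, add_comm _ c₁, this]
  exact crossRatio_le_crossRatio_pow hl ha hab hbc hcd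

/-- The rule by which the outer points of a quadruple are moved: as long as the outer point `a` is
on the same side of the critical point as the inner points (represented by `w`) it is mapped by
the dynamics; otherwise it is reset to `e`, a point beyond the critical value. -/
noncomputable def nextLimit (l : ℕ) (c₁ e w a : ℝ) : ℝ :=
  if 0 ≤ a * w then powMap l c₁ a else e

lemma nextLimit_neg (he : Even l) (e w a : ℝ) :
    nextLimit l c₁ e (-w) (-a) = nextLimit l c₁ e w a := by
  simp [nextLimit, powMap_neg he]

lemma crossRatio_step_of_lt (hl : 2 ≤ l) {h t : ℝ} (hh : 0 < h) (h0 : 0 ≤ t)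
    (h1 : t ≤ 1) {a b c d w : ℝ} (hab : a < b) (hbc : b < c) (hcd : c < d) (hw : 0 < w)
    (hb : h ≤ b) (ha : a * w < 0 → t ^ l * h ≤ |a|) :
    (nextLimit l c₁ (c₁ - t * h ^ l) w a < powMap l c₁ b ∧ powMap l c₁ b < powMap l c₁ c ∧
      powMap l c₁ c < nextLimit l c₁ (c₁ - t * h ^ l) w d) ∧
    crossRatio a b c d ≤ crossRatio (nextLimit l c₁ (c₁ - t * h ^ l) w a) (powMap l c₁ b)
      (powMap l c₁ c) (nextLimit l c₁ (c₁ - t * h ^ l) w d) := by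
  have hl0 : l ≠ 0 := by omega
  have hmono : StrictMonoOn (powMap l c₁) (Ici 0) := powMap_strictMonoOn hl0
  have hb0 : 0 < b := by linarith
  have hd : nextLimit l c₁ (c₁ - t * h ^ l) w d = powMap l c₁ d := by
    rw [nextLimit, if_pos]; exact mul_nonneg (by linarith) hw.le
  have f1 : powMap l c₁ b < powMap l c₁ c :=
    hmono hb0.le (show 0 ≤ c by linarith) hbc
  have f2 : powMap l c₁ c < powMap l c₁ d :=
    hmono (show 0 ≤ c by linarith) (show 0 ≤ d by linarith) hcd
  rw [hd]
  rcases le_or_gt 0 a with h | h'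
  · rw [nextLimit, if_pos (mul_nonneg h hw.le)]
    exact ⟨⟨hmono h hb0.le hab, f1, f2⟩, crossRatio_powMap_le hl0 h hab hbc hcd⟩
  · have hneg : a * w < 0 := mul_neg_of_neg_of_pos h' hw
    rw [nextLimit, if_neg (not_le.2 hneg)]
    have hx := ha hneg
    rw [abs_of_neg h'] at hx
    refine ⟨⟨?_, f1, f2⟩, ?_⟩
    · have : 0 < b ^ l := pow_pos hb0 l
      have : 0 ≤ t * h ^ l := by positivity
      simp only [powMap]; linarith
    · have key := crossRatio_jump hl h0 h1 (x := -a / h) (e := b / h) (v := c / h) (z := d / h)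
        (by rw [le_div_iff₀ hh]; exact hx) (by rw [le_div_iff₀ hh]; linarith)
        (div_lt_div_of_pos_right hbc hh) (div_lt_div_of_pos_right hcd hh)
      rw [neg_div, neg_neg, crossRatio_div hh.ne',
        ← crossRatio_affine (pow_pos hh l).ne' c₁ (-t)] at key
      have e : ∀ x : ℝ, c₁ + (x / h) ^ l * h ^ l = powMap l c₁ x := fun x => by
        rw [div_pow, div_mul_cancel₀ _ (pow_pos hh l).ne', powMap, add_comm]
      rw [e, e, e, show c₁ + -t * h ^ l = c₁ - t * h ^ l by ring] at key
      exact key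

/-- One step of the dynamics, with the outer points moved by `nextLimit`, does not decrease the
cross-ratio. -/
lemma crossRatio_step (hl : 2 ≤ l) (he : Even l) {h t : ℝ} (hh : 0 < h) (h0 : 0 ≤ t)
    (h1 : t ≤ 1) {a b c d w : ℝ} (ho : InOrder a b c d) (hb : h ≤ |b|) (hc : h ≤ |c|)
    (hbw : 0 < b * w) (hcw : 0 < c * w) (ha : a * w < 0 → t ^ l * h ≤ |a|)
    (hd : d * w < 0 → t ^ l * h ≤ |d|) :
    InOrder (nextLimit l c₁ (c₁ - t * h ^ l) w a) (powMap l c₁ b)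
      (powMap l c₁ c) (nextLimit l c₁ (c₁ - t * h ^ l) w d) ∧
    crossRatio a b c d ≤ crossRatio (nextLimit l c₁ (c₁ - t * h ^ l) w a) (powMap l c₁ b)
      (powMap l c₁ c) (nextLimit l c₁ (c₁ - t * h ^ l) w d) := by
  have main : ∀ {a b c d w : ℝ}, 0 < w → InOrder a b c d → h ≤ |b| → h ≤ |c| →
      0 < b * w → 0 < c * w → (a * w < 0 → t ^ l * h ≤ |a|) → (d * w < 0 → t ^ l * h ≤ |d|) →
      InOrder (nextLimit l c₁ (c₁ - t * h ^ l) w a) (powMap l c₁ b)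
        (powMap l c₁ c) (nextLimit l c₁ (c₁ - t * h ^ l) w d) ∧
      crossRatio a b c d ≤ crossRatio (nextLimit l c₁ (c₁ - t * h ^ l) w a) (powMap l c₁ b)
        (powMap l c₁ c) (nextLimit l c₁ (c₁ - t * h ^ l) w d) := by
    intro a b c d w hw ho hb hc hbw hcw ha hd
    rw [abs_of_pos ((mul_pos_iff_of_pos_right hw).1 hbw)] at hb
    rw [abs_of_pos ((mul_pos_iff_of_pos_right hw).1 hcw)] at hc
    rcases ho with ⟨o1, o2, o3⟩ | ⟨o1, o2, o3⟩
    · have := crossRatio_step_of_lt (c₁ := c₁) hl hh h0 h1 o1 o2 o3 hw hb ha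
      exact ⟨Or.inl this.1, this.2⟩
    · have := crossRatio_step_of_lt (c₁ := c₁) hl hh h0 h1 o1 o2 o3 hw hc hd
      refine ⟨Or.inr this.1, ?_⟩
      rw [← crossRatio_reverse a, ← crossRatio_reverse (nextLimit l c₁ (c₁ - t * h ^ l) w a)]
      exact this.2
  rcases lt_trichotomy w 0 with hw | rfl | hw
  · have := main (a := -a) (b := -b) (c := -c) (d := -d) (w := -w) (by linarith)
      (by unfold InOrder at ho ⊢; simpa [and_comm, and_left_comm, and_assoc, or_comm] using ho)
      (by simpa using hb) (by simpa using hc) (by simpa using hbw) (by simpa using hcw)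
      (by simpa using ha) (by simpa using hd)
    rwa [nextLimit_neg he, nextLimit_neg he, powMap_neg he, powMap_neg he,
      crossRatio_neg] at this
  · simp at hbw
  · exact main hw ho hb hc hbw hcw ha hd

/-! ### Chains of intervals and the smallest interval argument -/

/-- The interval `[c₁ - t h ^ l, c₁ + h ^ l]` around the critical value, of which the part to the
right of `c₁` is the image of `[-h, h]`. -/
def tube (l : ℕ) (c₁ h t : ℝ) : Set ℝ := Icc (c₁ - t * h ^ l) (c₁ + h ^ l)

/-- The images of orders `0, …, s - 2` of the tube avoid `(-h, h)`, and the image of order `s - 1` contains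
the critical point in its interior and has an end at distance `h` from it. The condition
`t ^ l * h ≤ |f^(s-1) (c₁ - t h ^ l)|` on the other end is what the jump inequality needs.
For `t = 0` the tube is the image of `[-h, h]`. -/
structure IsTubeCycle (l : ℕ) (c₁ h t : ℝ) (s : ℕ) : Prop where
  two_le_exp : 2 ≤ l
  even : Even l
  two_le : 2 ≤ s
  pos : 0 < h
  nonneg : 0 ≤ t
  le_one : t ≤ 1
  outside : ∀ y ∈ tube l c₁ h t, ∀ n, n + 1 < s → h ≤ |(powMap l c₁)^[n] y|
  right_end : |(powMap l c₁)^[s - 1] (c₁ + h ^ l)| = h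
  left_end : t ^ l * h ≤ |(powMap l c₁)^[s - 1] (c₁ - t * h ^ l)|
  opposite : (powMap l c₁)^[s - 1] (c₁ - t * h ^ l) * (powMap l c₁)^[s - 1] (c₁ + h ^ l) < 0

/-- `w` is one of the two ends of the tube. -/
def IsTubeEnd (l : ℕ) (c₁ h t w : ℝ) : Prop := w = c₁ - t * h ^ l ∨ w = c₁ + h ^ l

/-- Admissible outer points at time `n`: either points far away, or ends of another interval
`f^b(tube)` of the cycle that lies entirely between the point and `f^n(tube)`. -/
def IsOuterPoint (l : ℕ) (c₁ h t : ℝ) (s : ℕ) (M : ℝ) (n : ℕ) (a : ℝ) : Prop :=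
  M ≤ |a| ∨ ∃ b, b < s ∧ b ≠ n ∧ ∃ w₀, IsTubeEnd l c₁ h t w₀ ∧ a = (powMap l c₁)^[b] w₀ ∧
    ∀ y ∈ tube l c₁ h t, ∀ w ∈ tube l c₁ h t,
      (powMap l c₁)^[b] y ∈ uIcc ((powMap l c₁)^[n] w) a

/-- A family of conditions on outer points that is invariant under `nextLimit`. -/
def IsPropagated (l : ℕ) (c₁ h t : ℝ) (s : ℕ) (P : ℕ → ℝ → Prop) : Prop :=
  ∀ n, n + 1 < s → ∀ a, P n a →
    P (n + 1) (nextLimit l c₁ (c₁ - t * h ^ l) ((powMap l c₁)^[n] c₁) a) ∧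
    (a * (powMap l c₁)^[n] c₁ < 0 → t ^ l * h ≤ |a|)

namespace IsTubeCycle
variable {h t : ℝ} {s : ℕ}

lemma exp_ne_zero (H : IsTubeCycle l c₁ h t s) : l ≠ 0 := by
  have := H.two_le_exp; omega

lemma pow_pos' (H : IsTubeCycle l c₁ h t s) : 0 < h ^ l := pow_pos H.pos l

lemma left_le (H : IsTubeCycle l c₁ h t s) : c₁ - t * h ^ l ≤ c₁ := by
  have := mul_nonneg H.nonneg H.pow_pos'.le; linarith

lemma left_lt_right (H : IsTubeCycle l c₁ h t s) : c₁ - t * h ^ l < c₁ + h ^ l := by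
  linarith [H.left_le, H.pow_pos']

lemma left_mem (H : IsTubeCycle l c₁ h t s) : c₁ - t * h ^ l ∈ tube l c₁ h t :=
  ⟨le_rfl, H.left_lt_right.le⟩

lemma right_mem (H : IsTubeCycle l c₁ h t s) : c₁ + h ^ l ∈ tube l c₁ h t :=
  ⟨H.left_lt_right.le, le_rfl⟩

lemma center_mem (H : IsTubeCycle l c₁ h t s) : c₁ ∈ tube l c₁ h t :=
  ⟨H.left_le, by linarith [H.pow_pos']⟩

lemma end_mem (H : IsTubeCycle l c₁ h t s) {w : ℝ} (hw : IsTubeEnd l c₁ h t w) :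
    w ∈ tube l c₁ h t := by
  rcases hw with rfl | rfl
  exacts [H.left_mem, H.right_mem]

lemma pow_mul_le (H : IsTubeCycle l c₁ h t s) : t ^ l * h ≤ h := by
  have := pow_le_one₀ (n := l) H.nonneg H.le_one
  nlinarith [H.pos]

lemma mul_pos_of_mem (H : IsTubeCycle l c₁ h t s) {n : ℕ} (hn : n + 1 < s) {y w : ℝ}
    (hy : y ∈ tube l c₁ h t) (hw : w ∈ tube l c₁ h t) :
    0 < (powMap l c₁)^[n] y * (powMap l c₁)^[n] w := by
  by_contra hcon
  have h0 : (0 : ℝ) ∈ uIcc ((powMap l c₁)^[n] y) ((powMap l c₁)^[n] w) := by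
    rw [mem_uIcc]
    rcases mul_nonpos_iff.1 (not_lt.1 hcon) with ⟨h1, h2⟩ | ⟨h1, h2⟩
    exacts [Or.inr ⟨h2, h1⟩, Or.inl ⟨h1, h2⟩]
  obtain ⟨z, hz, hz0⟩ := intermediate_value_uIcc
    (continuous_powMap_iterate (l := l) (c₁ := c₁) n).continuousOn h0
  have := H.outside z (ordConnected_Icc.uIcc_subset hy hw hz) n hn
  rw [hz0, abs_zero] at this
  exact absurd this (not_le.2 H.pos)

lemma iterate_mem_uIcc (H : IsTubeCycle l c₁ h t s) {n : ℕ} (hn : n < s) {y : ℝ}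
    (hy : y ∈ tube l c₁ h t) : (powMap l c₁)^[n] y ∈
      uIcc ((powMap l c₁)^[n] (c₁ - t * h ^ l)) ((powMap l c₁)^[n] (c₁ + h ^ l)) := by
  induction n with
  | zero => exact Icc_subset_uIcc hy
  | succ n ih =>
    simp only [Function.iterate_succ_apply']
    exact powMap_mem_uIcc H.exp_ne_zero H.even
      (H.mul_pos_of_mem hn H.left_mem H.right_mem).le (ih (by omega))

lemma iterate_injOn (H : IsTubeCycle l c₁ h t s) {n : ℕ} (hn : n < s) :
    InjOn ((powMap l c₁)^[n]) (tube l c₁ h t) := by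
  induction n with
  | zero => exact fun x _ y _ hxy => hxy
  | succ n ih =>
    intro x hx y hy hxy
    simp only [Function.iterate_succ_apply'] at hxy
    exact ih (by omega) hx hy (powMap_injective_of_mul_nonneg H.exp_ne_zero H.even
      (H.mul_pos_of_mem hn hx hy).le hxy)

lemma right_le_iterate_succ (H : IsTubeCycle l c₁ h t s) {n : ℕ} (hn : n + 1 < s) {y : ℝ}
    (hy : y ∈ tube l c₁ h t) : c₁ + h ^ l ≤ (powMap l c₁)^[n + 1] y := by
  rw [Function.iterate_succ_apply', ← powMap_abs H.even, powMap, add_comm]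
  have := pow_le_pow_left₀ H.pos.le (H.outside y hy n hn) l
  linarith

/-- Outer points are propagated: an interval of the cycle between the outer point and the current
interval is mapped to such an interval, and after a jump it is replaced by the tube itself. -/
lemma isPropagated_isOuterPoint (H : IsTubeCycle l c₁ h t s) {M : ℝ} (hM : h ≤ M)
    (hesc : ∀ x, M ≤ |x| → M ≤ |powMap l c₁ x|) :
    IsPropagated l c₁ h t s (IsOuterPoint l c₁ h t s M) := by
  intro n hn a ha
  constructor
  · unfold nextLimit
    split_ifs with hp
    · rcases ha with ha | ⟨b, hbs, hbn, w₀, hw₀, rfl, hsub⟩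
      · exact Or.inl (hesc a ha)
      · rw [mul_comm] at hp
        have hb : b ≠ s - 1 := by
          rintro rfl
          have := mul_nonneg_of_mem_uIcc hp (hsub _ H.left_mem _ H.center_mem)
            (hsub _ H.right_mem _ H.center_mem)
          exact absurd H.opposite (not_lt.2 this)
        refine Or.inr ⟨b + 1, by omega, by omega, w₀, hw₀,
          (Function.iterate_succ_apply' _ _ _).symm, fun y hy w hw => ?_⟩
        simp only [Function.iterate_succ_apply']
        refine powMap_mem_uIcc H.exp_ne_zero H.even ?_ (hsub y hy w hw)
        have hcw := H.mul_pos_of_mem hn H.center_mem hw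
        rcases mul_pos_iff.1 hcw with ⟨h1, h2⟩ | ⟨h1, h2⟩
        · exact mul_nonneg h2.le (nonneg_of_mul_nonneg_right hp h1)
        · refine mul_nonneg_of_nonpos_of_nonpos h2.le ?_
          by_contra hcon
          exact absurd hp (not_le.2 (mul_neg_of_neg_of_pos h1 (not_le.1 hcon)))
    · refine Or.inr ⟨0, by omega, by omega, _, Or.inl rfl, rfl, fun y hy w hw => ?_⟩
      have := H.right_le_iterate_succ hn hw
      rw [mem_uIcc]
      exact Or.inr ⟨hy.1, hy.2.trans this⟩
  · intro hneg
    rcases ha with ha | ⟨b, hbs, hbn, w₀, hw₀, rfl, hsub⟩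
    · exact H.pow_mul_le.trans (hM.trans ha)
    · by_cases hb : b + 1 < s
      · exact H.pow_mul_le.trans (H.outside _ (H.end_mem hw₀) b hb)
      · obtain rfl : b = s - 1 := by omega
        rcases hw₀ with rfl | rfl
        · exact H.left_end
        · rw [H.right_end]; exact H.pow_mul_le

lemma isPropagated_inner (H : IsTubeCycle l c₁ h t s) {y : ℝ} (hy : y ∈ tube l c₁ h t) :
    IsPropagated l c₁ h t s fun n a => a = (powMap l c₁)^[n] y := by
  rintro n hn _ rfl
  have := H.mul_pos_of_mem hn hy H.center_mem
  refine ⟨?_, fun hneg => absurd hneg (not_lt.2 this.le)⟩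
  simp only [nextLimit, if_pos this.le, Function.iterate_succ_apply']

/-- Quadruples whose inner points lie in the tube can be pushed forward along the cycle without
decreasing the cross-ratio. -/
lemma exists_pushforward (H : IsTubeCycle l c₁ h t s) {P Q : ℕ → ℝ → Prop}
    (hP : IsPropagated l c₁ h t s P) (hQ : IsPropagated l c₁ h t s Q) {a b c d : ℝ}
    (ha : P 0 a) (hd : Q 0 d) (hb : b ∈ tube l c₁ h t) (hc : c ∈ tube l c₁ h t)
    (ho : InOrder a b c d) {n : ℕ} (hn : n < s) :
    ∃ a' d', P n a' ∧ Q n d' ∧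
      InOrder a' ((powMap l c₁)^[n] b) ((powMap l c₁)^[n] c) d' ∧
      crossRatio a b c d ≤ crossRatio a' ((powMap l c₁)^[n] b) ((powMap l c₁)^[n] c) d' := by
  induction n with
  | zero => exact ⟨a, d, ha, hd, ho, le_rfl⟩
  | succ n ih =>
    obtain ⟨a', d', ha', hd', ho', hle⟩ := ih (by omega)
    obtain ⟨pa, qa⟩ := hP n hn a' ha'
    obtain ⟨pd, qd⟩ := hQ n hn d' hd'
    have := crossRatio_step (c₁ := c₁) H.two_le_exp H.even H.pos H.nonneg H.le_one ho'
      (H.outside b hb n hn) (H.outside c hc n hn) (H.mul_pos_of_mem hn hb H.center_mem)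
      (H.mul_pos_of_mem hn hc H.center_mem) qa qd
    refine ⟨_, _, pa, pd, ?_, ?_⟩ <;> simp only [Function.iterate_succ_apply']
    exacts [this.1, hle.trans this.2]

/-- Outer points at time `n` are at distance at least `|f^k(tube)|` from `f^n(tube)`, if
`f^k(tube)` is the shortest interval of the cycle. -/
lemma length_le_of_isOuterPoint (H : IsTubeCycle l c₁ h t s) {M : ℝ} {n k : ℕ} {a w : ℝ}
    (hk : ∀ b < s, |(powMap l c₁)^[k] (c₁ + h ^ l) - (powMap l c₁)^[k] (c₁ - t * h ^ l)| ≤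
      |(powMap l c₁)^[b] (c₁ + h ^ l) - (powMap l c₁)^[b] (c₁ - t * h ^ l)|)
    (hw : w ∈ tube l c₁ h t)
    (hM : |(powMap l c₁)^[k] (c₁ + h ^ l) - (powMap l c₁)^[k] (c₁ - t * h ^ l)| +
      |(powMap l c₁)^[n] w| ≤ M)
    (ha : IsOuterPoint l c₁ h t s M n a) :
    |(powMap l c₁)^[k] (c₁ + h ^ l) - (powMap l c₁)^[k] (c₁ - t * h ^ l)| ≤
      |a - (powMap l c₁)^[n] w| := by
  rcases ha with ha | ⟨b, hbs, -, w₀, hw₀, rfl, hsub⟩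
  · linarith [abs_sub_abs_le_abs_sub a ((powMap l c₁)^[n] w)]
  · refine (hk b hbs).trans ?_
    exact abs_sub_le_of_uIcc_subset_uIcc (uIcc_subset_uIcc (hsub _ H.left_mem w hw)
      (hsub _ H.right_mem w hw))

/-- The smallest interval of the cycle has on each side an interval of the cycle that is at least
as long. Pulling this space back to the tube shows that `f^n(tube)`, `n < s - 1`, reaches at least
as far as the `l`-th root of `1 + (1 + t) / 3` times `h`. -/
lemma exists_end_le (H : IsTubeCycle l c₁ h t s) {n : ℕ} (hn : n + 1 < s) :
    ∃ w, IsTubeEnd l c₁ h t w ∧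
      (1 + (1 + t) / 3) * h ^ l ≤ |(powMap l c₁)^[n] w| ^ l := by
  set e₀ := c₁ - t * h ^ l with he₀
  set e₁ := c₁ + h ^ l with he₁
  obtain ⟨k, hks, hk⟩ := Finset.exists_min_image (Finset.range s)
    (fun k => |(powMap l c₁)^[k] e₁ - (powMap l c₁)^[k] e₀|)
    ⟨0, Finset.mem_range.2 (by have := H.two_le; omega)⟩
  rw [Finset.mem_range] at hks
  have hk' : ∀ b < s, |(powMap l c₁)^[k] e₁ - (powMap l c₁)^[k] e₀| ≤
      |(powMap l c₁)^[b] e₁ - (powMap l c₁)^[b] e₀| := fun b hb => hk b (Finset.mem_range.2 hb)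
  set J := |(powMap l c₁)^[k] e₁ - (powMap l c₁)^[k] e₀| with hJ
  obtain ⟨M, hMB, hesc⟩ := exists_escape_radius H.two_le_exp H.even c₁
    (max h (max (J + |(powMap l c₁)^[k] e₀|) (max (J + |(powMap l c₁)^[k] e₁|) (|e₀| + 1))))
  simp only [max_le_iff] at hMB
  obtain ⟨hMh, hM0, hM1, hM2⟩ := hMB
  have hP := H.isPropagated_isOuterPoint hMh hesc
  -- the far end of the interval `f^(n+1)(tube)`, which lies to the right of the tube
  obtain ⟨w, hw, hwmax⟩ : ∃ w, IsTubeEnd l c₁ h t w ∧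
      max ((powMap l c₁)^[n + 1] e₀) ((powMap l c₁)^[n + 1] e₁) = (powMap l c₁)^[n + 1] w := by
    rcases le_total ((powMap l c₁)^[n + 1] e₀) ((powMap l c₁)^[n + 1] e₁) with h' | h'
    · exact ⟨e₁, Or.inr rfl, max_eq_right h'⟩
    · exact ⟨e₀, Or.inl rfl, max_eq_left h'⟩
  refine ⟨w, hw, ?_⟩
  have hlt : e₁ < (powMap l c₁)^[n + 1] w := by
    rw [← hwmax]
    have i0 := H.right_le_iterate_succ hn H.left_mem
    have i1 := H.right_le_iterate_succ hn H.right_mem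
    have hne : (powMap l c₁)^[n + 1] e₀ ≠ (powMap l c₁)^[n + 1] e₁ := fun heq =>
      H.left_lt_right.ne (H.iterate_injOn hn H.left_mem H.right_mem heq)
    rw [← he₁] at i0 i1
    rcases lt_or_gt_of_ne hne with h' | h'
    · exact lt_max_of_lt_right (lt_of_le_of_lt i0 h')
    · exact lt_max_of_lt_left (lt_of_le_of_lt i1 h')
  have hd : IsOuterPoint l c₁ h t s M 0 ((powMap l c₁)^[n + 1] w) := by
    refine Or.inr ⟨n + 1, hn, by omega, w, hw, rfl, fun y hy x hx => ?_⟩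
    have h1 := H.right_le_iterate_succ hn hy
    have h2 := (H.iterate_mem_uIcc hn hy).2
    rw [← hwmax, mem_uIcc]
    exact Or.inl ⟨hx.2.trans h1, h2⟩
  have hMe : -M < e₀ := by linarith [neg_abs_le e₀]
  have ha : IsOuterPoint l c₁ h t s M 0 (-M) := Or.inl (by rw [abs_neg]; exact le_abs_self M)
  obtain ⟨a', d', ha', hd', ho, hle⟩ := H.exists_pushforward hP hP ha hd H.left_mem H.right_mem
    (Or.inl ⟨hMe, H.left_lt_right, hlt⟩) hks
  have h3 := hle.trans (crossRatio_le_three ho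
    (H.length_le_of_isOuterPoint hk' H.left_mem hM0 ha')
    (H.length_le_of_isOuterPoint hk' H.right_mem hM1 hd'))
  have h4 := (div_le_crossRatio hMe H.left_lt_right hlt).trans h3
  rw [div_le_iff₀ (by linarith)] at h4
  rw [Function.iterate_succ_apply', ← powMap_abs H.even, powMap] at h4
  simp only [he₀] at h4
  linarith

end IsTubeCycle

/-! ### Infinitely renormalizable maps have no attracted critical point -/

lemma exists_tendsto_iterate_of_monotoneOn {g : ℝ → ℝ} {α β x : ℝ}
    (hg : MonotoneOn g (Icc α β)) (hm : MapsTo g (Icc α β) (Icc α β)) (hx : x ∈ Icc α β) :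
    ∃ z, Filter.Tendsto (fun n => g^[n] x) Filter.atTop (nhds z) := by
  have hmem : ∀ n, g^[n] x ∈ Icc α β := fun n => hm.iterate n hx
  rcases le_total x (g x) with h | h
  · have hmono : Monotone fun n => g^[n] x := by
      refine monotone_nat_of_le_succ fun n => ?_
      induction n with
      | zero => exact h
      | succ n ih =>
        simp only [Function.iterate_succ_apply'] at ih ⊢
        exact hg (hmem n) (hm (hmem n)) ih
    exact ⟨_, tendsto_atTop_ciSup hmono ⟨β, by rintro _ ⟨n, rfl⟩; exact (hmem n).2⟩⟩
  · have hanti : Antitone fun n => g^[n] x := by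
      refine antitone_nat_of_succ_le fun n => ?_
      induction n with
      | zero => exact h
      | succ n ih =>
        simp only [Function.iterate_succ_apply'] at ih ⊢
        exact hg (hm (hmem n)) (hmem n) ih
    exact ⟨_, tendsto_atTop_ciInf hanti ⟨α, by rintro _ ⟨n, rfl⟩; exact (hmem n).1⟩⟩

lemma infinite_iterate_image (hl : l ≠ 0) (he : Even l) (n : ℕ) {S : Set ℝ} (hS : S.Infinite) :
    ((powMap l c₁)^[n] '' S).Infinite := by
  induction n with
  | zero => simpa using hS
  | succ n ih =>
    rw [Function.iterate_succ', image_comp]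
    intro hfin
    refine ih (Finite.subset (Finite.preimage' hfin fun b _ => ?_) (subset_preimage_image _ _))
    rcases (powMap l c₁ ⁻¹' {b}).eq_empty_or_nonempty with h0 | ⟨x, hx⟩
    · rw [h0]; exact finite_empty
    · refine Finite.subset (toFinite {x, -x}) fun y hy => ?_
      have hxy : powMap l c₁ |y| = powMap l c₁ |x| := by
        rw [powMap_abs he, powMap_abs he]; exact hy.trans hx.symm
      have := powMap_injective_of_mul_nonneg hl he
        (mul_nonneg (abs_nonneg y) (abs_nonneg x)) hxy
      rcases abs_eq_abs.1 this with h | h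
      exacts [Or.inl h, Or.inr h]

lemma IsPeriodicInterval.abs_le_of_mem_image {f : ℝ → ℝ} {s : ℕ} {u : ℝ}
    (hV : IsPeriodicInterval f s u) {i : ℕ} (h0 : 0 < i) (hi : i < s) {x : ℝ}
    (hx : |x| ≤ |u|) : |u| ≤ |f^[i] x| := by
  by_contra hcon
  have h1 : f^[i] x ∈ f^[i] '' symInterval u := mem_image_of_mem _ (abs_le.1 hx)
  have h2 : f^[i] x ∈ interior (symInterval u) := by
    rw [symInterval, interior_Icc]; exact abs_lt.1 (not_le.1 hcon)
  exact (hV.disjoint i h0 hi).le_bot ⟨h1, h2⟩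

lemma IsPeriodicInterval.abs_iterate_le {f : ℝ → ℝ} {s : ℕ} {u : ℝ}
    (hV : IsPeriodicInterval f s u) {x : ℝ} (hx : |x| ≤ |u|) : |f^[s] x| ≤ |u| :=
  abs_le.2 (hV.mapsTo (abs_le.1 hx))

/-- An interval outside `(-|z|, |z|)` with end point `z` contains a one-sided neighbourhood of
`z`. -/
lemma exists_mul_mem_of_infinite {A : Set ℝ} (hA : A.OrdConnected) (hinf : A.Infinite) {z : ℝ}
    (hz : z ∈ A) (hz0 : z ≠ 0) (hout : ∀ x ∈ A, |z| ≤ |x|) :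
    ∃ ε > 0, ∀ τ ∈ Icc (0 : ℝ) ε, z * (1 + τ) ∈ A := by
  obtain ⟨x, hx, hxz⟩ := hinf.exists_notMem_finite (finite_singleton z)
  rw [mem_singleton_iff] at hxz
  have hsub := hA.uIcc_subset hz hx
  have hgt : 1 < x / z := by
    by_contra hcon
    have hr : x / z < 1 := lt_of_le_of_ne (not_lt.1 hcon) fun h => hxz ((div_eq_one_iff_eq hz0).1 h)
    set r := max (x / z) 0 with hrdef
    have hr1 : r < 1 := max_lt hr one_pos
    have hr0 : 0 ≤ r := le_max_right _ _
    have hmem : z * r ∈ uIcc z x := by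
      have hxe : x = z * (x / z) := by field_simp
      rw [mem_uIcc]
      rcases lt_or_gt_of_ne hz0 with h | h
      · refine Or.inl ⟨by nlinarith, ?_⟩
        rw [hxe]
        exact mul_le_mul_of_nonpos_left (le_max_left _ _) h.le
      · refine Or.inr ⟨?_, by nlinarith⟩
        rw [hxe]
        exact mul_le_mul_of_nonneg_left (le_max_left _ _) h.le
    have := hout _ (hsub hmem)
    rw [abs_mul, abs_of_nonneg hr0] at this
    nlinarith [abs_pos.2 hz0]
  refine ⟨x / z - 1, by linarith, fun τ hτ => hsub ?_⟩
  have hxe : x = z * (x / z) := by field_simp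
  rw [mem_uIcc]
  rcases lt_or_gt_of_ne hz0 with h | h
  · refine Or.inr ⟨?_, by nlinarith [hτ.1]⟩
    rw [hxe]
    exact mul_le_mul_of_nonpos_left (by linarith [hτ.2]) h.le
  · refine Or.inl ⟨by nlinarith [hτ.1], ?_⟩
    rw [hxe]
    exact mul_le_mul_of_nonneg_left (by linarith [hτ.2]) h.le

/-- The critical orbit of an infinitely renormalizable map does not converge to a periodic orbit.
Otherwise a periodic interval `V` of a period larger than twice that of the limit cycle would share
a limit point `z` with `f^s(V)` and `f^(2s)(V)`, which would overlap next to `z`. -/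
lemma not_tendsto_of_infinitelyRenormalizable (hl : l ≠ 0) (he : Even l)
    (hI : InfinitelyRenormalizable (powMap l c₁)) {s : ℕ} (hs : 0 < s) (j : ℕ) (z : ℝ) :
    ¬ Filter.Tendsto (fun n => (powMap l c₁)^[n * s + j] 0) Filter.atTop (nhds z) := by
  intro hz
  set f := powMap l c₁ with hf
  have hcont : ∀ n, Continuous (f^[n]) := fun n => continuous_powMap_iterate n
  -- the limit along multiples of `s`
  obtain ⟨y, hy⟩ : ∃ y, Filter.Tendsto (fun n => f^[n * s] 0) Filter.atTop (nhds y) := by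
    refine ⟨f^[j * (s - 1)] z, ?_⟩
    rw [← Filter.tendsto_add_atTop_iff_nat j]
    refine (((hcont (j * (s - 1))).tendsto z).comp hz).congr fun n => ?_
    rw [Function.comp_apply, ← Function.iterate_add_apply]
    congr 2
    obtain ⟨m, rfl⟩ : ∃ m, s = m + 1 := ⟨s - 1, by omega⟩
    rw [Nat.add_sub_cancel]
    ring
  have hfix : f^[s] y = y := by
    refine tendsto_nhds_unique (((hcont s).tendsto y).comp hy) ?_
    refine ((Filter.tendsto_add_atTop_iff_nat 1).2 hy).congr fun n => ?_
    rw [Function.comp_apply, ← Function.iterate_add_apply]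
    congr 2; ring
  obtain ⟨N, hN, v, hV⟩ := hI (2 * s + 1)
  have hyV : |y| ≤ |v| := by
    have hmem : ∀ n, f^[n * N * s] 0 ∈ symInterval v := by
      intro n
      rw [show n * N * s = N * (n * s) by ring, Function.iterate_mul]
      exact hV.mapsTo.iterate _ (abs_le.1 (by simp))
    refine abs_le.2 ((isClosed_Icc).mem_of_tendsto (hy.comp
      (Filter.tendsto_id.atTop_mul_const' (show 0 < N by omega)))
      (Filter.Eventually.of_forall hmem))
  have hvy : |v| ≤ |y| := by
    have := hV.abs_le_of_mem_image hs (by omega) hyV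
    rwa [hfix] at this
  have hyv : |y| = |v| := le_antisymm hyV hvy
  have hy0 : y ≠ 0 := fun h => hV.ne_zero (by rw [h, abs_zero] at hyv; exact abs_eq_zero.1 hyv.symm)
  have hymem : y ∈ symInterval v := abs_le.1 hyV
  have hVinf : (symInterval v).Infinite := Icc_infinite (by
    have := abs_pos.2 hV.ne_zero; linarith)
  have side : ∀ i, 0 < i → i < N → f^[i] y = y →
      ∃ ε > 0, ∀ τ ∈ Icc (0 : ℝ) ε, y * (1 + τ) ∈ f^[i] '' symInterval v := by
    intro i h0 hi hfi
    refine exists_mul_mem_of_infinite ?_ (infinite_iterate_image hl he i hVinf) ⟨y, hymem, hfi⟩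
      hy0 ?_
    · exact (isPreconnected_Icc.image _ (hcont i).continuousOn).ordConnected
    · rintro _ ⟨x, hx, rfl⟩
      rw [hyv]
      exact hV.abs_le_of_mem_image h0 hi (abs_le.2 hx)
  obtain ⟨ε₁, hε₁, h₁⟩ := side s hs (by omega) hfix
  obtain ⟨ε₂, hε₂, h₂⟩ := side (s + s) (by omega) (by omega)
    (by rw [Function.iterate_add_apply, hfix, hfix])
  set S := (fun τ => y * (1 + τ)) '' Icc (0 : ℝ) (min ε₁ ε₂)
  have hSinf : S.Infinite := by
    refine (Icc_infinite (lt_min hε₁ hε₂)).image fun a _ b _ hab => ?_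
    have := mul_left_cancel₀ hy0 hab
    linarith
  refine infinite_iterate_image (c₁ := c₁) hl he (N - s) hSinf ?_
  refine Finite.subset (toFinite {v, -v}) ?_
  rintro _ ⟨_, ⟨τ, hτ, rfl⟩, rfl⟩
  obtain ⟨x₁, hx₁, e₁⟩ := h₁ τ ⟨hτ.1, hτ.2.trans (min_le_left _ _)⟩
  obtain ⟨x₂, hx₂, e₂⟩ := h₂ τ ⟨hτ.1, hτ.2.trans (min_le_right _ _)⟩
  have a₁ : |f^[N - s] (y * (1 + τ))| ≤ |v| := by
    rw [← e₁, ← Function.iterate_add_apply, Nat.sub_add_cancel (by omega)]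
    exact hV.abs_iterate_le (abs_le.2 hx₁)
  have a₂ : |v| ≤ |f^[N - s] (y * (1 + τ))| := by
    rw [← e₂, ← Function.iterate_add_apply, show N - s + (s + s) = s + N by omega,
      Function.iterate_add_apply]
    exact hV.abs_le_of_mem_image hs (by omega) (hV.abs_iterate_le (abs_le.2 hx₂))
  rcases abs_eq_abs.1 (le_antisymm a₁ a₂) with h | h
  exacts [Or.inl h, Or.inr h]

/-! ### Intervals of monotonicity of iterates -/

/-- The first `n` iterates, of orders `0, …, n - 1`, of `T` each stay on one side of the critical
point. -/
def IsFoldFree (l : ℕ) (c₁ : ℝ) (n : ℕ) (T : Set ℝ) : Prop :=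
  ∀ i < n, ∀ x ∈ T, ∀ y ∈ T, 0 ≤ (powMap l c₁)^[i] x * (powMap l c₁)^[i] y

lemma nonneg_or_nonpos_of_mul_nonneg {T : Set ℝ} {g : ℝ → ℝ}
    (h : ∀ x ∈ T, ∀ y ∈ T, 0 ≤ g x * g y) : (∀ x ∈ T, 0 ≤ g x) ∨ ∀ x ∈ T, g x ≤ 0 := by
  by_cases hex : ∃ x ∈ T, 0 < g x
  · obtain ⟨x, hx, hx0⟩ := hex
    exact Or.inl fun y hy => nonneg_of_mul_nonneg_right (h x hx y hy) hx0
  · push Not at hex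
    exact Or.inr hex

lemma IsFoldFree.strictMonoOn_or_strictAntiOn (hl : l ≠ 0) (he : Even l) {n : ℕ} {T : Set ℝ}
    (h : IsFoldFree l c₁ n T) :
    StrictMonoOn ((powMap l c₁)^[n]) T ∨ StrictAntiOn ((powMap l c₁)^[n]) T := by
  induction n with
  | zero => exact Or.inl fun x _ y _ hxy => hxy
  | succ n ih =>
    rw [Function.iterate_succ']
    rcases nonneg_or_nonpos_of_mul_nonneg (h n (Nat.lt_succ_self n)) with hs | hs
    · rcases ih fun i hi => h i (by omega) with hm | hm
      · exact Or.inl ((powMap_strictMonoOn hl).comp hm hs)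
      · exact Or.inr ((powMap_strictMonoOn hl).comp_strictAntiOn hm hs)
    · rcases ih fun i hi => h i (by omega) with hm | hm
      · exact Or.inr ((powMap_strictAntiOn hl he).comp_strictMonoOn hm hs)
      · exact Or.inl ((powMap_strictAntiOn hl he).comp hm hs)

lemma crossRatio_powMap_le_of_inOrder (hl : l ≠ 0) (he : Even l) {a b c d : ℝ}
    (ho : InOrder a b c d) (hs : (0 ≤ a ∧ 0 ≤ d) ∨ (a ≤ 0 ∧ d ≤ 0)) :
    InOrder (powMap l c₁ a) (powMap l c₁ b) (powMap l c₁ c) (powMap l c₁ d) ∧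
    crossRatio a b c d ≤
      crossRatio (powMap l c₁ a) (powMap l c₁ b) (powMap l c₁ c) (powMap l c₁ d) := by
  have hm := powMap_strictMonoOn (c₁ := c₁) hl
  have key : ∀ {a b c d : ℝ}, InOrder a b c d → 0 ≤ a → 0 ≤ d →
      InOrder (powMap l c₁ a) (powMap l c₁ b) (powMap l c₁ c) (powMap l c₁ d) ∧
      crossRatio a b c d ≤
        crossRatio (powMap l c₁ a) (powMap l c₁ b) (powMap l c₁ c) (powMap l c₁ d) := by
    intro a b c d ho ha hd
    rcases ho with ⟨h1, h2, h3⟩ | ⟨h1, h2, h3⟩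
    · have hb : 0 ≤ b := by linarith
      have hc : 0 ≤ c := by linarith
      exact ⟨Or.inl ⟨hm ha hb h1, hm hb hc h2, hm hc hd h3⟩,
        crossRatio_powMap_le hl ha h1 h2 h3⟩
    · have hb : 0 ≤ b := by linarith
      have hc : 0 ≤ c := by linarith
      refine ⟨Or.inr ⟨hm hd hc h1, hm hc hb h2, hm hb ha h3⟩, ?_⟩
      rw [← crossRatio_reverse a, ← crossRatio_reverse (powMap l c₁ a)]
      exact crossRatio_powMap_le hl hd h1 h2 h3
  rcases hs with ⟨ha, hd⟩ | ⟨ha, hd⟩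
  · exact key ho ha hd
  · have := key (a := -a) (b := -b) (c := -c) (d := -d)
      (by unfold InOrder at ho ⊢; simpa [and_comm, and_left_comm, and_assoc, or_comm] using ho)
      (by linarith) (by linarith)
    simpa only [powMap_neg he, crossRatio_neg] using this

/-- Iterates expand cross-ratios on intervals of monotonicity. -/
lemma IsFoldFree.crossRatio_le (hl : l ≠ 0) (he : Even l) {n : ℕ} {T : Set ℝ}
    (h : IsFoldFree l c₁ n T) {a b c d : ℝ} (ha : a ∈ T) (hd : d ∈ T) (ho : InOrder a b c d) :
    crossRatio a b c d ≤ crossRatio ((powMap l c₁)^[n] a) ((powMap l c₁)^[n] b)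
      ((powMap l c₁)^[n] c) ((powMap l c₁)^[n] d) := by
  have main : InOrder ((powMap l c₁)^[n] a) ((powMap l c₁)^[n] b)
      ((powMap l c₁)^[n] c) ((powMap l c₁)^[n] d) ∧
      crossRatio a b c d ≤ crossRatio ((powMap l c₁)^[n] a) ((powMap l c₁)^[n] b)
        ((powMap l c₁)^[n] c) ((powMap l c₁)^[n] d) := by
    induction n with
    | zero => exact ⟨ho, le_rfl⟩
    | succ n ih =>
      obtain ⟨ho', hle⟩ := ih fun i hi => h i (by omega)
      simp only [Function.iterate_succ_apply']
      have := crossRatio_powMap_le_of_inOrder (c₁ := c₁) hl he ho'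
        (mul_nonneg_iff.1 (h n (Nat.lt_succ_self n) a ha d hd))
      exact ⟨this.1, hle.trans this.2⟩
  exact main.2

/-- An interval on which an iterate is monotone is not folded: a fold at time `i` would produce
two points with opposite images at time `i`, hence with the same image under the iterate, which
would then be constant between them. -/
lemma isFoldFree_of_monotoneOn (hl : l ≠ 0) (he : Even l) {n : ℕ} {T : Set ℝ}
    (hT : T.OrdConnected)
    (hm : MonotoneOn ((powMap l c₁)^[n]) T ∨ AntitoneOn ((powMap l c₁)^[n]) T) :
    IsFoldFree l c₁ n T := by
  intro i hi x hx y hy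
  by_contra hcon
  have hneg := not_le.1 hcon
  set p := (powMap l c₁)^[i] x with hp
  set q := (powMap l c₁)^[i] y with hq
  have hε : 0 < min |p| |q| := by
    have : p ≠ 0 := fun h => by rw [h, zero_mul] at hneg; exact lt_irrefl _ hneg
    have : q ≠ 0 := fun h => by rw [h, mul_zero] at hneg; exact lt_irrefl _ hneg
    positivity
  set ε := min |p| |q| with hεdef
  have hε1 : ε ≤ |p| := min_le_left _ _
  have hε2 : ε ≤ |q| := min_le_right _ _
  have hmem : ε ∈ uIcc p q ∧ -ε ∈ uIcc p q := by
    simp only [mem_uIcc]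
    rcases mul_neg_iff.1 hneg with ⟨h1, h2⟩ | ⟨h1, h2⟩
    · rw [abs_of_pos h1] at hε1
      rw [abs_of_neg h2] at hε2
      exact ⟨Or.inr ⟨by linarith, by linarith⟩, Or.inr ⟨by linarith, by linarith⟩⟩
    · rw [abs_of_neg h1] at hε1
      rw [abs_of_pos h2] at hε2
      exact ⟨Or.inl ⟨by linarith, by linarith⟩, Or.inl ⟨by linarith, by linarith⟩⟩
  have ivt := intermediate_value_uIcc (a := x) (b := y)
    (continuous_powMap_iterate (l := l) (c₁ := c₁) i).continuousOn
  obtain ⟨z₁, hz₁, e₁⟩ := ivt hmem.1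
  obtain ⟨z₂, hz₂, e₂⟩ := ivt hmem.2
  have hsub := hT.uIcc_subset hx hy
  have hsub' := hT.uIcc_subset (hsub hz₁) (hsub hz₂)
  have hne : z₁ ≠ z₂ := fun h => by rw [h, e₂] at e₁; linarith
  have heq : (powMap l c₁)^[n] z₁ = (powMap l c₁)^[n] z₂ := by
    obtain ⟨k, rfl⟩ : ∃ k, n = k + (i + 1) := ⟨n - (i + 1), by omega⟩
    rw [Function.iterate_add_apply _ k (i + 1), Function.iterate_add_apply _ k (i + 1),
      Function.iterate_succ_apply' _ i, Function.iterate_succ_apply' _ i, e₁, e₂, powMap_neg he]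
  have hinf : (uIcc z₁ z₂).Infinite := Icc_infinite (by simpa using hne.symm)
  refine infinite_iterate_image (c₁ := c₁) hl he n hinf
    ((finite_singleton ((powMap l c₁)^[n] z₁)).subset ?_)
  rintro _ ⟨z, hz, rfl⟩
  rw [mem_singleton_iff]
  have hz' : (powMap l c₁)^[n] z ∈ uIcc ((powMap l c₁)^[n] z₁) ((powMap l c₁)^[n] z₂) := by
    rcases hm with hm | hm
    · exact (hm.mono hsub').mapsTo_uIcc hz
    · exact (hm.mono hsub').mapsTo_uIcc hz
  rw [← heq, uIcc_self] at hz'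
  exact hz'

/-- The maximal interval of monotonicity around `A` contains all unfolded intervals around `A`. -/
lemma subset_of_isMaximalMonotoneInterval (hl : l ≠ 0) (he : Even l) {n : ℕ} {A T T₁ : Set ℝ}
    (hT₁ : IsMaximalMonotoneInterval ((powMap l c₁)^[n]) A T₁) {a : ℝ} (ha : a ∈ A)
    (ha0 : ∀ i < n, (powMap l c₁)^[i] a ≠ 0) (hT : T.OrdConnected) (haT : a ∈ T)
    (hfree : IsFoldFree l c₁ n T) : T ⊆ T₁ := by
  obtain ⟨hord, hsub, hmon⟩ := hT₁.prop
  have hfree₁ := isFoldFree_of_monotoneOn hl he hord hmon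
  have hU : IsFoldFree l c₁ n (T₁ ∪ T) := by
    intro i hi x hx y hy
    have key : ∀ z ∈ T₁ ∪ T, 0 ≤ (powMap l c₁)^[i] a * (powMap l c₁)^[i] z := by
      rintro z (hz | hz)
      exacts [hfree₁ i hi a (hsub ha) z hz, hfree i hi a haT z hz]
    have h1 := key x hx
    have h2 := key y hy
    have h3 : 0 < (powMap l c₁)^[i] a ^ 2 := by have := ha0 i hi; positivity
    have h4 := mul_nonneg h1 h2
    refine nonneg_of_mul_nonneg_right (a := (powMap l c₁)^[i] a ^ 2) ?_ h3
    linarith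
  have hconn : (T₁ ∪ T).OrdConnected :=
    (IsPreconnected.union a (hsub ha) haT hord.isPreconnected hT.isPreconnected).ordConnected
  have hmem : IsMonotoneIntervalAround ((powMap l c₁)^[n]) A (T₁ ∪ T) := by
    refine ⟨hconn, hsub.trans subset_union_left, ?_⟩
    rcases hU.strictMonoOn_or_strictAntiOn hl he with h | h
    exacts [Or.inl h.monotoneOn, Or.inr h.antitoneOn]
  exact subset_union_right.trans (hT₁.le_of_ge hmem subset_union_left)

/-! ### The first return map as a branch composed with a power -/

/-- The iterate `f^(s-1)` near the critical value in normalized coordinates: the critical value is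
at `0`, the image of `u` at `1`, and lengths in the range are measured in units of `u`. The first
return map is then `x ↦ branch (x ^ l)`. -/
noncomputable def branch (l : ℕ) (c₁ : ℝ) (s : ℕ) (u y : ℝ) : ℝ :=
  (powMap l c₁)^[s - 1] (c₁ + y * |u| ^ l) / u

/-- The domain of monotonicity in normalized coordinates. -/
def branchDomain (l : ℕ) (c₁ u : ℝ) (T₁ : Set ℝ) : Set ℝ := {y | c₁ + y * |u| ^ l ∈ T₁}

lemma powMap_mul (he : Even l) (x u : ℝ) : powMap l c₁ (x * u) = c₁ + x ^ l * |u| ^ l := by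
  rw [powMap, mul_pow, he.pow_abs, add_comm]

lemma branch_pow (he : Even l) {s : ℕ} (hs : 2 ≤ s) (u x : ℝ) :
    branch l c₁ s u (x ^ l) = (powMap l c₁)^[s] (x * u) / u := by
  obtain ⟨m, rfl⟩ : ∃ m, s = m + 1 := ⟨s - 1, by omega⟩
  rw [branch, ← powMap_mul he, Nat.add_sub_cancel, Function.iterate_succ_apply]

lemma continuous_branch (s : ℕ) (u : ℝ) : Continuous (branch l c₁ s u) := by
  unfold branch
  have := continuous_powMap_iterate (l := l) (c₁ := c₁) (s - 1)
  fun_prop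

lemma iterate_rescaled (n s : ℕ) {u : ℝ} (hu : u ≠ 0) (x : ℝ) :
    (fun x => (powMap l c₁)^[s] (x * u) / u)^[n] x = (powMap l c₁)^[n * s] (x * u) / u := by
  induction n with
  | zero => simp [hu]
  | succ n ih =>
    rw [Function.iterate_succ_apply', ih, div_mul_cancel₀ _ hu, ← Function.iterate_add_apply]
    congr 3; ring

/-- A monotone self-map of an interval which is a rescaled iterate cannot have a point of the
critical orbit in this interval. -/
lemma not_mem_of_monotoneOn_rescaled (hl : l ≠ 0) (he : Even l)
    (hI : InfinitelyRenormalizable (powMap l c₁)) {s : ℕ} (hs : 0 < s) {u : ℝ} (hu : u ≠ 0)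
    {α β : ℝ} (hg : MonotoneOn (fun x => (powMap l c₁)^[s] (x * u) / u) (Icc α β))
    (hm : MapsTo (fun x => (powMap l c₁)^[s] (x * u) / u) (Icc α β) (Icc α β)) (j : ℕ) :
    (powMap l c₁)^[j] 0 / u ∉ Icc α β := by
  intro hmem
  obtain ⟨z, hz⟩ := exists_tendsto_iterate_of_monotoneOn hg hm hmem
  refine not_tendsto_of_infinitelyRenormalizable hl he hI hs j (z * u)
    ((hz.mul_const u).congr fun n => ?_)
  rw [iterate_rescaled n s hu, div_mul_cancel₀ _ hu, div_mul_cancel₀ _ hu,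
    ← Function.iterate_add_apply]

lemma isFoldFree_Icc (n : ℕ) {α β : ℝ}
    (h : ∀ i < n, ∀ x ∈ Ioo α β, (powMap l c₁)^[i] x ≠ 0) :
    IsFoldFree l c₁ n (Icc α β) := by
  intro i hi x hx y hy
  by_contra hcon
  have hneg := not_le.1 hcon
  have h0 : (0 : ℝ) ∈ uIcc ((powMap l c₁)^[i] x) ((powMap l c₁)^[i] y) := by
    rw [mem_uIcc]
    rcases mul_neg_iff.1 hneg with ⟨h1, h2⟩ | ⟨h1, h2⟩
    exacts [Or.inr ⟨h2.le, h1.le⟩, Or.inl ⟨h1.le, h2.le⟩]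
  obtain ⟨z, hz, hz0⟩ := intermediate_value_uIcc
    (continuous_powMap_iterate (l := l) (c₁ := c₁) i).continuousOn h0
  have hzx : z ≠ x := by rintro rfl; rw [hz0, zero_mul] at hneg; exact lt_irrefl _ hneg
  have hzy : z ≠ y := by rintro rfl; rw [hz0, mul_zero] at hneg; exact lt_irrefl _ hneg
  refine h i hi z ?_ hz0
  rcases mem_uIcc.1 hz with ⟨h1, h2⟩ | ⟨h1, h2⟩
  · exact ⟨hx.1.trans_lt (lt_of_le_of_ne h1 hzx.symm), (lt_of_le_of_ne h2 hzy).trans_le hy.2⟩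
  · exact ⟨hy.1.trans_lt (lt_of_le_of_ne h1 hzy.symm), (lt_of_le_of_ne h2 hzx).trans_le hx.2⟩

/-- A periodic interval of an infinitely renormalizable unicritical map of even degree. -/
structure IsDeepPeriodicInterval (l : ℕ) (c₁ : ℝ) (s : ℕ) (u : ℝ) : Prop where
  two_le_exp : 2 ≤ l
  even : Even l
  infinitely : InfinitelyRenormalizable (powMap l c₁)
  periodic : IsPeriodicInterval (powMap l c₁) s u

namespace IsDeepPeriodicInterval
variable {s : ℕ} {u : ℝ} {T₁ : Set ℝ}

lemma exp_ne_zero (S : IsDeepPeriodicInterval l c₁ s u) : l ≠ 0 := by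
  have := S.two_le_exp; omega

lemma two_le (S : IsDeepPeriodicInterval l c₁ s u) : 2 ≤ s := S.periodic.two_le

lemma abs_pos' (S : IsDeepPeriodicInterval l c₁ s u) : 0 < |u| := abs_pos.2 S.periodic.ne_zero

lemma pow_pos' (S : IsDeepPeriodicInterval l c₁ s u) : 0 < |u| ^ l := pow_pos S.abs_pos' l

lemma abs_le_iterate_of_mem (S : IsDeepPeriodicInterval l c₁ s u) {y : ℝ}
    (hy : y ∈ Icc c₁ (c₁ + |u| ^ l)) {n : ℕ} (hn : n + 1 < s) :
    |u| ≤ |(powMap l c₁)^[n] y| := by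
  obtain ⟨x, hx, rfl⟩ := intermediate_value_Icc (abs_nonneg u)
    (continuous_powMap_iterate (l := l) (c₁ := c₁) 1).continuousOn
    (show y ∈ Icc _ _ by simpa [powMap, S.exp_ne_zero, add_comm] using hy)
  rw [← Function.iterate_add_apply]
  exact S.periodic.abs_le_of_mem_image (by omega) hn (by rw [abs_of_nonneg hx.1]; exact hx.2)

lemma branch_one (S : IsDeepPeriodicInterval l c₁ s u) : branch l c₁ s u 1 = 1 := by
  have := branch_pow (c₁ := c₁) S.even S.two_le u 1
  rw [one_pow, one_mul, S.periodic.fixed, div_self S.periodic.ne_zero] at this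
  exact this

lemma branch_zero (S : IsDeepPeriodicInterval l c₁ s u) :
    branch l c₁ s u 0 = (powMap l c₁)^[s] 0 / u := by
  have := branch_pow (c₁ := c₁) S.even S.two_le u 0
  rwa [zero_pow S.exp_ne_zero, zero_mul] at this

lemma abs_branch_zero_le (S : IsDeepPeriodicInterval l c₁ s u) : |branch l c₁ s u 0| ≤ 1 := by
  rw [S.branch_zero, abs_div, div_le_one S.abs_pos']
  exact S.periodic.abs_iterate_le (by simp)

lemma isFoldFree_core (S : IsDeepPeriodicInterval l c₁ s u) :
    IsFoldFree l c₁ (s - 1) (Icc c₁ (c₁ + |u| ^ l)) := by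
  refine isFoldFree_Icc _ fun i hi x hx h0 => ?_
  have := S.abs_le_iterate_of_mem (Ioo_subset_Icc_self hx) (n := i) (by omega)
  rw [h0, abs_zero] at this
  exact absurd this (not_le.2 S.abs_pos')

lemma monotoneOn_branch_of_isFoldFree (S : IsDeepPeriodicInterval l c₁ s u)
    (hfree : IsFoldFree l c₁ (s - 1) T₁) (h0 : c₁ ∈ T₁) (h1 : c₁ + |u| ^ l ∈ T₁) :
    StrictMonoOn (branch l c₁ s u) (branchDomain l c₁ u T₁) := by
  have hpos := S.pow_pos'
  have d0 : (0 : ℝ) ∈ branchDomain l c₁ u T₁ := by simpa [branchDomain] using h0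
  have d1 : (1 : ℝ) ∈ branchDomain l c₁ u T₁ := by simpa [branchDomain] using h1
  have hor : StrictMonoOn (branch l c₁ s u) (branchDomain l c₁ u T₁) ∨
      StrictAntiOn (branch l c₁ s u) (branchDomain l c₁ u T₁) := by
    have haff : ∀ {x y : ℝ}, x < y → c₁ + x * |u| ^ l < c₁ + y * |u| ^ l := fun hxy => by
      nlinarith
    rcases lt_or_gt_of_ne S.periodic.ne_zero with hu | hu <;>
    rcases hfree.strictMonoOn_or_strictAntiOn S.exp_ne_zero S.even with hm | hm
    · exact Or.inr fun x hx y hy hxy => div_lt_div_of_neg_of_lt hu (hm hx hy (haff hxy))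
    · exact Or.inl fun x hx y hy hxy => div_lt_div_of_neg_of_lt hu (hm hx hy (haff hxy))
    · exact Or.inl fun x hx y hy hxy => div_lt_div_of_pos_right (hm hx hy (haff hxy)) hu
    · exact Or.inr fun x hx y hy hxy => div_lt_div_of_pos_right (hm hx hy (haff hxy)) hu
  refine hor.resolve_right fun h => ?_
  have := h d0 d1 one_pos
  rw [S.branch_one] at this
  linarith [(abs_le.1 S.abs_branch_zero_le).2]

lemma strictMonoOn_branch_Icc (S : IsDeepPeriodicInterval l c₁ s u) :
    StrictMonoOn (branch l c₁ s u) (Icc 0 1) := by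
  have hpos := S.pow_pos'
  refine (S.monotoneOn_branch_of_isFoldFree S.isFoldFree_core ⟨le_rfl, by linarith⟩
    ⟨by linarith, le_rfl⟩).mono fun y hy => ?_
  exact ⟨by nlinarith [hy.1], by nlinarith [hy.2]⟩

/-- The first return map reverses the sign of the critical point: otherwise it would be monotone
along the critical orbit. -/
lemma branch_zero_neg (S : IsDeepPeriodicInterval l c₁ s u) : branch l c₁ s u 0 < 0 := by
  by_contra hcon
  have h0 := not_lt.1 hcon
  have hm : MonotoneOn (fun x => (powMap l c₁)^[s] (x * u) / u) (Icc 0 1) := by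
    intro x hx y hy hxy
    simp only [← branch_pow S.even S.two_le]
    exact S.strictMonoOn_branch_Icc.monotoneOn ⟨pow_nonneg hx.1 l, pow_le_one₀ hx.1 hx.2⟩
      ⟨pow_nonneg hy.1 l, pow_le_one₀ hy.1 hy.2⟩ (pow_le_pow_left₀ hx.1 hxy l)
  have e0 : (powMap l c₁)^[s] (0 * u) / u = branch l c₁ s u 0 := by rw [S.branch_zero, zero_mul]
  have e1 : (powMap l c₁)^[s] (1 * u) / u = 1 := by
    rw [one_mul, S.periodic.fixed, div_self S.periodic.ne_zero]
  refine not_mem_of_monotoneOn_rescaled S.exp_ne_zero S.even S.infinitely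
    (by have := S.two_le; omega) S.periodic.ne_zero hm (fun x hx => ?_) 0
    (by simp)
  have i0 := hm (show (0 : ℝ) ∈ Icc 0 1 by simp) hx hx.1
  have i1 := hm hx (show (1 : ℝ) ∈ Icc 0 1 by simp) hx.2
  simp only [e0, e1] at i0 i1
  exact ⟨h0.trans i0, i1⟩

/-- The critical point returns to its own side after two returns: otherwise the second return map
would be monotone along the critical orbit. -/
lemma branch_pow_nonneg (S : IsDeepPeriodicInterval l c₁ s u) :
    0 ≤ branch l c₁ s u ((-branch l c₁ s u 0) ^ l) := by
  by_contra hcon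
  have hq := not_le.1 hcon
  set p := -branch l c₁ s u 0 with hp
  have hp0 : 0 < p := by linarith [S.branch_zero_neg]
  have hp1 : p ≤ 1 := by linarith [(abs_le.1 S.abs_branch_zero_le).1]
  set g : ℝ → ℝ := fun x => (powMap l c₁)^[s] (x * u) / u with hg
  have hgφ : ∀ x, g x = branch l c₁ s u (|x| ^ l) := fun x => by
    rw [S.even.pow_abs, branch_pow S.even S.two_le]
  have hI : ∀ x ∈ Icc (-p) 0, |x| ^ l ∈ Icc (0 : ℝ) 1 := fun x hx => by
    have : |x| ≤ 1 := by rw [abs_of_nonpos hx.2]; linarith [hx.1]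
    exact ⟨pow_nonneg (abs_nonneg x) l, pow_le_one₀ (abs_nonneg x) this⟩
  have hanti : AntitoneOn g (Icc (-p) 0) := fun x hx y hy hxy => by
    rw [hgφ, hgφ]
    refine S.strictMonoOn_branch_Icc.monotoneOn (hI y hy) (hI x hx)
      (pow_le_pow_left₀ (abs_nonneg y) ?_ l)
    rw [abs_of_nonpos hx.2, abs_of_nonpos hy.2]; linarith
  have hmaps : MapsTo g (Icc (-p) 0) (Icc (-p) 0) := fun x hx => by
    have i0 := hanti hx (show (0 : ℝ) ∈ Icc (-p) 0 from ⟨by linarith, le_rfl⟩) hx.2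
    have i1 := hanti (show -p ∈ Icc (-p) 0 from ⟨le_rfl, by linarith⟩) hx hx.1
    have e0 : g 0 = -p := by rw [hgφ, abs_zero, zero_pow S.exp_ne_zero, hp, neg_neg]
    have e1 : g (-p) = branch l c₁ s u (p ^ l) := by rw [hgφ, abs_neg, abs_of_pos hp0]
    rw [e0] at i0
    rw [e1] at i1
    exact ⟨i0, i1.trans hq.le⟩
  have e : (fun x => (powMap l c₁)^[s + s] (x * u) / u) = g ∘ g := by
    ext x
    simp only [hg, Function.comp_apply, Function.iterate_add_apply]
    rw [div_mul_cancel₀ _ S.periodic.ne_zero]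
  refine not_mem_of_monotoneOn_rescaled S.exp_ne_zero S.even S.infinitely (s := s + s)
    (by have := S.two_le; omega) S.periodic.ne_zero (α := -p) (β := 0) ?_ ?_ 0 (by simp [hp0.le])
  · rw [e]; exact hanti.comp hanti hmaps
  · rw [e]; exact hmaps.comp hmaps

lemma iterate_eq_branch_mul (S : IsDeepPeriodicInterval l c₁ s u) (y : ℝ) :
    (powMap l c₁)^[s - 1] (c₁ + y * |u| ^ l) = branch l c₁ s u y * u := by
  rw [branch, div_mul_cancel₀ _ S.periodic.ne_zero]

/-- The criterion for the interval `[c₁ - t |u| ^ l, c₁ + |u| ^ l]` to generate a cycle to which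
the smallest interval argument applies. -/
lemma isTubeCycle (S : IsDeepPeriodicInterval l c₁ s u) {t : ℝ} (h0 : 0 ≤ t) (h1 : t ≤ 1)
    (hout : ∀ y ∈ Icc (c₁ - t * |u| ^ l) c₁, ∀ n, n + 1 < s → |u| ≤ |(powMap l c₁)^[n] y|)
    (hb : branch l c₁ s u (-t) ≤ -t ^ l) (hneg : branch l c₁ s u (-t) < 0) :
    IsTubeCycle l c₁ |u| t s where
  two_le_exp := S.two_le_exp
  even := S.even
  two_le := S.two_le
  pos := S.abs_pos'
  nonneg := h0
  le_one := h1
  outside y hy n hn := by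
    rcases le_total y c₁ with h | h
    · exact hout y ⟨hy.1, h⟩ n hn
    · exact S.abs_le_iterate_of_mem ⟨h, hy.2⟩ hn
  right_end := by
    have := S.iterate_eq_branch_mul 1
    rw [one_mul] at this
    rw [this, S.branch_one, one_mul]
  left_end := by
    have := S.iterate_eq_branch_mul (-t)
    rw [neg_mul, ← sub_eq_add_neg] at this
    rw [this, abs_mul, abs_of_neg hneg]
    exact mul_le_mul_of_nonneg_right (by linarith) (abs_nonneg u)
  opposite := by
    have e0 := S.iterate_eq_branch_mul (-t)
    have e1 := S.iterate_eq_branch_mul 1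
    rw [neg_mul, ← sub_eq_add_neg] at e0
    rw [one_mul] at e1
    rw [e0, e1, S.branch_one, one_mul, mul_assoc]
    exact mul_neg_of_neg_of_pos hneg (mul_self_pos.2 S.periodic.ne_zero)

lemma isTubeCycle_zero (S : IsDeepPeriodicInterval l c₁ s u) : IsTubeCycle l c₁ |u| 0 s := by
  refine S.isTubeCycle le_rfl zero_le_one (fun y hy n hn => ?_) ?_ ?_
  · rw [zero_mul, sub_zero, Icc_self, mem_singleton_iff] at hy
    exact S.abs_le_iterate_of_mem (by rw [hy]; exact ⟨le_rfl, by linarith [S.pow_pos']⟩) hn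
  · rw [neg_zero, zero_pow S.exp_ne_zero, neg_zero]; exact S.branch_zero_neg.le
  · rw [neg_zero]; exact S.branch_zero_neg

lemma right_end_neg (S : IsDeepPeriodicInterval l c₁ s u) : c₁ + |u| ^ l < 0 := by
  have H := S.isTubeCycle_zero
  have hs := S.two_le
  have hpos := H.mul_pos_of_mem (n := 0) (by omega) H.center_mem H.right_mem
  simp only [Function.iterate_zero, id] at hpos
  rcases mul_pos_iff.1 hpos with ⟨h0, -⟩ | ⟨-, h⟩
  · exfalso
    have hinv : ∀ n : ℕ, ∀ y : ℝ, 0 ≤ y → 0 ≤ (powMap l c₁)^[n] y := by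
      intro n
      induction n with
      | zero => exact fun y hy => hy
      | succ n ih =>
        intro y hy
        rw [Function.iterate_succ_apply]
        exact ih _ (by unfold powMap; positivity)
    have h1 := hinv (s - 1) (c₁ - 0 * |u| ^ l) (by linarith)
    have h2 := hinv (s - 1) (c₁ + |u| ^ l) (by have := S.pow_pos'; linarith)
    exact absurd H.opposite (not_lt.2 (mul_nonneg h1 h2))
  · exact h

/-- Between a point of `f(V)` and a turning point `t` of `f^(s-1)` there is a point that
`f^(s-1)` maps far away from `V`: the image of the interval between them contains some
`f^j(V)`, `0 < j < s`. -/
lemma exists_far_of_turning (S : IsDeepPeriodicInterval l c₁ s u) {y t : ℝ}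
    (hy : y ∈ Icc c₁ (c₁ + |u| ^ l)) {m : ℕ} (hm : m < s - 1) (ht : (powMap l c₁)^[m] t = 0) :
    ∃ x ∈ uIcc y t, 4 / 3 * |u| ^ l ≤ |(powMap l c₁)^[s - 1] x| ^ l := by
  have hym := S.abs_le_iterate_of_mem hy (n := m) (by omega)
  have hcont : Continuous fun x => |(powMap l c₁)^[m] x| :=
    (continuous_powMap_iterate m).abs
  obtain ⟨x, hx, hxu⟩ := intermediate_value_uIcc (a := y) (b := t) hcont.continuousOn
    (show |u| ∈ uIcc _ _ by
      simp only [ht, abs_zero]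
      exact mem_uIcc.2 (Or.inr ⟨abs_nonneg u, hym⟩))
  simp only at hxu
  obtain ⟨w, hw, hfar⟩ := S.isTubeCycle_zero.exists_end_le (n := s - 1 - m - 1) (by omega)
  have e : ∀ z, (powMap l c₁)^[s - 1] z =
      (powMap l c₁)^[s - 1 - m - 1] (powMap l c₁ ((powMap l c₁)^[m] z)) := by
    intro z
    rw [← Function.iterate_succ_apply, ← Function.iterate_add_apply]
    congr 2; omega
  rw [show (1 + (1 + 0) / 3 : ℝ) = 4 / 3 by norm_num] at hfar
  rcases hw with rfl | rfl
  · refine ⟨t, right_mem_uIcc, ?_⟩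
    rw [e, ht, show powMap l c₁ 0 = c₁ - 0 * |u| ^ l by simp [powMap, S.exp_ne_zero]]
    exact hfar
  · refine ⟨x, hx, ?_⟩
    rw [e, ← powMap_abs S.even, hxu, show powMap l c₁ |u| = c₁ + |u| ^ l by
      simp [powMap, add_comm]]
    exact hfar

end IsDeepPeriodicInterval

namespace IsDeepPeriodicInterval
variable {s : ℕ} {u : ℝ} {T₁ : Set ℝ}

/-! ### The maximal interval of monotonicity around the image of a periodic interval -/

lemma core_subset (S : IsDeepPeriodicInterval l c₁ s u)
    (hT₁ : IsMaximalMonotoneInterval ((powMap l c₁)^[s - 1]) (powMap l c₁ '' symInterval u) T₁) :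
    Icc c₁ (c₁ + |u| ^ l) ⊆ T₁ := by
  have h0 : c₁ ∈ powMap l c₁ '' symInterval u :=
    ⟨0, abs_le.1 (by simp), by simp [powMap, S.exp_ne_zero]⟩
  have h1 : c₁ + |u| ^ l ∈ powMap l c₁ '' symInterval u :=
    ⟨u, abs_le.1 le_rfl, by rw [← powMap_abs S.even, powMap, add_comm]⟩
  exact hT₁.prop.1.out (hT₁.prop.2.1 h0) (hT₁.prop.2.1 h1)

lemma isFoldFree_of_isMaximal (S : IsDeepPeriodicInterval l c₁ s u)
    (hT₁ : IsMaximalMonotoneInterval ((powMap l c₁)^[s - 1]) (powMap l c₁ '' symInterval u) T₁) :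
    IsFoldFree l c₁ (s - 1) T₁ :=
  isFoldFree_of_monotoneOn S.exp_ne_zero S.even hT₁.prop.1 hT₁.prop.2.2

lemma subset_of_isFoldFree (S : IsDeepPeriodicInterval l c₁ s u)
    (hT₁ : IsMaximalMonotoneInterval ((powMap l c₁)^[s - 1]) (powMap l c₁ '' symInterval u) T₁)
    {T : Set ℝ} (hT : T.OrdConnected) (h1 : c₁ + |u| ^ l ∈ T)
    (hfree : IsFoldFree l c₁ (s - 1) T) : T ⊆ T₁ := by
  refine subset_of_isMaximalMonotoneInterval S.exp_ne_zero S.even hT₁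
    (a := c₁ + |u| ^ l) ⟨u, abs_le.1 le_rfl, by rw [← powMap_abs S.even, powMap, add_comm]⟩
    (fun i hi h0 => ?_) hT h1 hfree
  have := S.abs_le_iterate_of_mem (y := c₁ + |u| ^ l) ⟨by linarith [S.pow_pos'], le_rfl⟩
    (n := i) (by omega)
  rw [h0, abs_zero] at this
  exact absurd this (not_le.2 S.abs_pos')

lemma ne_zero_of_mem_core (S : IsDeepPeriodicInterval l c₁ s u) {x : ℝ}
    (hx : x ∈ Icc c₁ (c₁ + |u| ^ l)) {i : ℕ} (hi : i < s - 1) : (powMap l c₁)^[i] x ≠ 0 := by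
  intro h0
  have := S.abs_le_iterate_of_mem hx (n := i) (by omega)
  rw [h0, abs_zero] at this
  exact absurd this (not_le.2 S.abs_pos')

lemma isClosed_turning (n : ℕ) : IsClosed {x | ∃ i < n, (powMap l c₁)^[i] x = 0} := by
  have : {x | ∃ i < n, (powMap l c₁)^[i] x = 0} =
      ⋃ i ∈ Iio n, (powMap l c₁)^[i] ⁻¹' {0} := by
    ext x; simp
  rw [this]
  exact (finite_Iio n).isClosed_biUnion fun i _ =>
    isClosed_singleton.preimage (continuous_powMap_iterate i)

/-- On the side of `f(V)` the interval of monotonicity ends at a turning point, at most at the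
critical point itself. -/
lemma exists_right_turning (S : IsDeepPeriodicInterval l c₁ s u)
    (hT₁ : IsMaximalMonotoneInterval ((powMap l c₁)^[s - 1]) (powMap l c₁ '' symInterval u) T₁) :
    ∃ t ∈ T₁, c₁ + |u| ^ l < t ∧ ∃ m < s - 1, (powMap l c₁)^[m] t = 0 := by
  have hs := S.two_le
  have hcomp : IsCompact (Icc (c₁ + |u| ^ l) 0 ∩ {x | ∃ i < s - 1, (powMap l c₁)^[i] x = 0}) :=
    isCompact_Icc.inter_right (isClosed_turning _)
  obtain ⟨t, ⟨htI, m, hm, htm⟩, hmin⟩ := hcomp.exists_isLeast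
    ⟨0, ⟨S.right_end_neg.le, le_rfl⟩, 0, by omega, rfl⟩
  have hlt : c₁ + |u| ^ l < t := by
    refine lt_of_le_of_ne htI.1 fun h => ?_
    refine S.ne_zero_of_mem_core (x := t) ?_ hm htm
    rw [← h]; exact ⟨by linarith [S.pow_pos'], le_rfl⟩
  refine ⟨t, S.subset_of_isFoldFree hT₁ (T := Icc c₁ t) ordConnected_Icc
    ⟨by linarith [S.pow_pos'], hlt.le⟩ (isFoldFree_Icc _ fun i hi x hx h0 => ?_)
    ⟨by linarith [S.pow_pos'], le_rfl⟩, hlt, m, hm, htm⟩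
  rcases le_or_gt x (c₁ + |u| ^ l) with h | h
  · exact S.ne_zero_of_mem_core ⟨hx.1.le, h⟩ hi h0
  · exact absurd hx.2 (not_lt.2 (hmin ⟨⟨h.le, hx.2.le.trans htI.2⟩, i, hi, h0⟩))

/-- To the left of the critical value the interval of monotonicity ends at a turning point or is
unbounded; in both cases it contains points with images far from `V`. -/
lemma exists_left_far (S : IsDeepPeriodicInterval l c₁ s u)
    (hT₁ : IsMaximalMonotoneInterval ((powMap l c₁)^[s - 1]) (powMap l c₁ '' symInterval u) T₁) :
    ∃ x ∈ T₁, x ≤ c₁ ∧ 4 / 3 * |u| ^ l ≤ |(powMap l c₁)^[s - 1] x| ^ l := by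
  have hpos := S.pow_pos'
  have hfree : ∀ {α : ℝ}, α ≤ c₁ →
      (∀ x ∈ Ioo α c₁, ∀ i < s - 1, (powMap l c₁)^[i] x ≠ 0) →
      Icc α (c₁ + |u| ^ l) ⊆ T₁ := by
    intro α hα hne
    refine S.subset_of_isFoldFree hT₁ ordConnected_Icc ⟨by linarith, le_rfl⟩
      (isFoldFree_Icc _ fun i hi x hx h0 => ?_)
    rcases le_or_gt c₁ x with h | h
    · exact S.ne_zero_of_mem_core ⟨h, hx.2.le⟩ hi h0
    · exact hne x ⟨hx.1, h⟩ i hi h0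
  by_cases hex : ∃ x₀ ≤ c₁, ∃ i < s - 1, (powMap l c₁)^[i] x₀ = 0
  · obtain ⟨x₀, hx₀, hi⟩ := hex
    have hcomp : IsCompact (Icc x₀ c₁ ∩ {x | ∃ i < s - 1, (powMap l c₁)^[i] x = 0}) :=
      isCompact_Icc.inter_right (isClosed_turning _)
    obtain ⟨t, ⟨htI, m, hm, htm⟩, hmax⟩ := hcomp.exists_isGreatest ⟨x₀, ⟨le_rfl, hx₀⟩, hi⟩
    have hsub := hfree htI.2 fun x hx i hi h0 =>
      absurd hx.1 (not_lt.2 (hmax ⟨⟨htI.1.trans hx.1.le, hx.2.le⟩, i, hi, h0⟩))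
    obtain ⟨x, hx, hfar⟩ := S.exists_far_of_turning (y := c₁) ⟨le_rfl, by linarith⟩ hm htm
    rw [uIcc_of_ge htI.2] at hx
    exact ⟨x, hsub ⟨hx.1, hx.2.trans (by linarith)⟩, hx.2, hfar⟩
  · push Not at hex
    obtain ⟨M, hM, hesc⟩ := exists_escape_radius S.two_le_exp S.even c₁ (max (2 * |u|) |c₁|)
    rw [max_le_iff] at hM
    have hle : -M ≤ c₁ := by linarith [neg_abs_le c₁]
    have hfar : ∀ n, M ≤ |(powMap l c₁)^[n] (-M)| := by
      intro n
      induction n with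
      | zero => simpa using le_abs_self M
      | succ n ih => rw [Function.iterate_succ_apply']; exact hesc _ ih
    refine ⟨-M, hfree hle (fun x hx i hi => hex x hx.2.le i hi) ⟨le_rfl, by linarith⟩, hle, ?_⟩
    have h1 := pow_le_pow_left₀ (by positivity) (hM.1.trans (hfar (s - 1))) l
    rw [mul_pow] at h1
    have h2 : (2 : ℝ) ≤ 2 ^ l := le_self_pow₀ (by norm_num) S.exp_ne_zero
    nlinarith

end IsDeepPeriodicInterval

/-- The properties of the normalized branch `φ` on its domain of monotonicity `I` from which the
real bounds are derived; `D` is the `l`-th root of `4 / 3`. -/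
structure BranchBounds (l : ℕ) (φ : ℝ → ℝ) (I : Set ℝ) (p D : ℝ) : Prop where
  ordConnected : I.OrdConnected
  zero_mem : (0 : ℝ) ∈ I
  one_mem : (1 : ℝ) ∈ I
  strictMonoOn : StrictMonoOn φ I
  continuous : Continuous φ
  map_one : φ 1 = 1
  map_zero : φ 0 = -p
  pos : 0 < p
  le_one : p ≤ 1
  crossRatio_le : ∀ {a b c d}, a ∈ I → d ∈ I → a < b → b < c → c < d →
    crossRatio a b c d ≤ crossRatio (φ a) (φ b) (φ c) (φ d)
  D_pos : 0 < D
  D_pow : D ^ l = 4 / 3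
  left : ∃ x ∈ I, x ≤ 0 ∧ φ x ≤ -D
  right : ∃ τ ∈ I, 1 < τ ∧ D ≤ φ τ ∧ ∀ x, 1 < x → x ^ l ≤ τ → x < φ (x ^ l)
  map_pow_nonneg : 0 ≤ φ (p ^ l)

namespace IsDeepPeriodicInterval
variable {s : ℕ} {u : ℝ} {T₁ : Set ℝ}

lemma le_abs_branch (S : IsDeepPeriodicInterval l c₁ s u) {D y : ℝ} (hD : 0 < D)
    (hDl : D ^ l = 4 / 3)
    (h : 4 / 3 * |u| ^ l ≤ |(powMap l c₁)^[s - 1] (c₁ + y * |u| ^ l)| ^ l) :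
    D ≤ |branch l c₁ s u y| := by
  rw [← hDl, ← mul_pow, pow_le_pow_iff_left₀ (mul_nonneg hD.le (abs_nonneg u)) (abs_nonneg _)
    S.exp_ne_zero] at h
  rw [branch, abs_div, le_div_iff₀ S.abs_pos']
  exact h

/-- The first return map has no fixed point between `u` and the end of its monotone branch: such a
point would trap the orbit of the end point, which belongs to the critical orbit. -/
lemma lt_branch_pow (S : IsDeepPeriodicInterval l c₁ s u) {τ : ℝ} (hτ : 1 < τ)
    (hmono : StrictMonoOn (branch l c₁ s u) (Icc 0 τ))
    (hcr : ∀ {a b c d}, a ∈ Icc 0 τ → d ∈ Icc 0 τ → a < b → b < c → c < d →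
      crossRatio a b c d ≤ crossRatio (branch l c₁ s u a) (branch l c₁ s u b)
        (branch l c₁ s u c) (branch l c₁ s u d))
    {j : ℕ} (hj : branch l c₁ s u τ = (powMap l c₁)^[j] 0 / u) {x : ℝ} (hx : 1 < x)
    (hxτ : x ^ l ≤ τ) : x < branch l c₁ s u (x ^ l) := by
  by_contra hcon
  have hgx := not_lt.1 hcon
  have hl := S.exp_ne_zero
  set p := -branch l c₁ s u 0 with hp
  have hp0 : 0 < p := by linarith [S.branch_zero_neg]
  set g : ℝ → ℝ := fun x => (powMap l c₁)^[s] (x * u) / u with hg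
  have hgφ : ∀ x, g x = branch l c₁ s u (x ^ l) := fun x => by rw [branch_pow S.even S.two_le]
  obtain ⟨X, hX0, hXτ⟩ : ∃ X : ℝ, 0 ≤ X ∧ X ^ l = τ :=
    ⟨τ ^ ((l : ℝ)⁻¹), by positivity, Real.rpow_inv_natCast_pow (by linarith) hl⟩
  have hxX : x ≤ X := by
    rw [← hXτ] at hxτ
    exact (pow_le_pow_iff_left₀ (by linarith) hX0 hl).1 hxτ
  have hI : ∀ y, 0 ≤ y → y ≤ X → y ^ l ∈ Icc 0 τ := fun y h0 h1 =>
    ⟨pow_nonneg h0 l, by rw [← hXτ]; exact pow_le_pow_left₀ h0 h1 l⟩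
  have gmono : ∀ {a b}, 0 ≤ a → a < b → b ≤ X → g a < g b := by
    intro a b h0 hab hb
    rw [hgφ, hgφ]
    exact hmono (hI a h0 (hab.le.trans hb)) (hI b (h0.trans hab.le) hb)
      (pow_lt_pow_left₀ hab h0 hl)
  have g1 : g 1 = 1 := by rw [hgφ, one_pow, S.branch_one]
  have g0 : g 0 = -p := by rw [hgφ, zero_pow hl, hp, neg_neg]
  have hgX : g X ≤ X := by
    by_contra hX
    have hX' := not_le.1 hX
    have hxX' : x < X := by
      refine lt_of_le_of_ne hxX fun h => ?_
      rw [h, ← hgφ] at hgx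
      exact hX hgx
    rw [← hgφ] at hgx
    have hX1 : 1 < X := hx.trans hxX'
    have k1 := crossRatio_le_crossRatio_pow hl le_rfl one_pos hx hxX'
    have k2 := hcr (a := 0 ^ l) (d := X ^ l) (hI 0 le_rfl hX0) (hI X hX0 le_rfl)
      (pow_lt_pow_left₀ one_pos le_rfl hl) (pow_lt_pow_left₀ hx zero_le_one hl)
      (pow_lt_pow_left₀ hxX' (by linarith) hl)
    simp only [← hgφ, g0, g1] at k2
    have k := k1.trans k2
    have gx1 : 1 < g x := by rw [← g1]; exact gmono zero_le_one hx hxX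
    unfold crossRatio at k
    rw [div_le_div_iff₀ (by nlinarith) (mul_pos (by linarith) (by linarith))] at k
    have m1 : (g x - 1) * (X - x) ≤ (x - 1) * (g X - g x) := by nlinarith
    have m2 : (X - x) * (g X + p) ≤ (g X - g x) * (X + p) := by
      nlinarith [mul_nonneg (sub_nonneg.2 hgx) (sub_nonneg.2 hX'.le),
        mul_nonneg (sub_nonneg.2 hgx) hp0.le, mul_nonneg hX0 (sub_nonneg.2 hgx)]
    have m3 : X + p < X * (1 + p) := by nlinarith
    have n1 : 0 < g X - g x := by linarith
    have n2 : 0 < (x - 1) * (g X - g x) := mul_pos (by linarith) n1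
    have n3 : (g x - 1) * (g X + p) * (X - x) ≤ (g x - 1) * ((g X - g x) * (X + p)) := by
      nlinarith [mul_le_mul_of_nonneg_left m2 (show 0 ≤ g x - 1 by linarith)]
    have n4 : (g x - 1) * (X + p) ≤ (x - 1) * (X + p) :=
      mul_le_mul_of_nonneg_right (by linarith) (by linarith)
    nlinarith [mul_lt_mul_of_pos_left m3 n2, mul_le_mul_of_nonneg_left n4 n1.le]
  have hX1 : 1 < X := hx.trans_le hxX
  have hm : MonotoneOn g (Icc 1 X) := by
    intro a ha b hb hab
    rcases hab.eq_or_lt with rfl | hab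
    · exact le_rfl
    · exact (gmono (by linarith [ha.1]) hab hb.2).le
  have hmaps : MapsTo g (Icc 1 X) (Icc 1 X) := fun a ha => by
    have i0 := hm (show (1 : ℝ) ∈ Icc 1 X from ⟨le_rfl, hX1.le⟩) ha ha.1
    have i1 := hm ha (show X ∈ Icc 1 X from ⟨hX1.le, le_rfl⟩) ha.2
    rw [g1] at i0
    exact ⟨i0, i1.trans hgX⟩
  refine not_mem_of_monotoneOn_rescaled hl S.even S.infinitely (by have := S.two_le; omega)
    S.periodic.ne_zero hm hmaps j ?_
  rw [← hj, ← hXτ, ← hgφ]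
  exact hmaps ⟨hX1.le, le_rfl⟩

lemma branchBounds (S : IsDeepPeriodicInterval l c₁ s u)
    (hT₁ : IsMaximalMonotoneInterval ((powMap l c₁)^[s - 1]) (powMap l c₁ '' symInterval u) T₁) :
    BranchBounds l (branch l c₁ s u) (branchDomain l c₁ u T₁)
      (-branch l c₁ s u 0) ((4 / 3 : ℝ) ^ ((l : ℝ)⁻¹)) := by
  have hpos := S.pow_pos'
  have hl := S.exp_ne_zero
  have hcore := S.core_subset hT₁
  have hord : (branchDomain l c₁ u T₁).OrdConnected := by
    refine ⟨fun x hx y hy z hz => hT₁.prop.1.out hx hy ⟨?_, ?_⟩⟩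
    · nlinarith [hz.1]
    · nlinarith [hz.2]
  have hfree := S.isFoldFree_of_isMaximal hT₁
  have d0 : (0 : ℝ) ∈ branchDomain l c₁ u T₁ := by
    simpa [branchDomain] using hcore (show c₁ ∈ _ from ⟨le_rfl, by linarith⟩)
  have d1 : (1 : ℝ) ∈ branchDomain l c₁ u T₁ := by
    simpa [branchDomain] using hcore (show c₁ + |u| ^ l ∈ _ from ⟨by linarith, le_rfl⟩)
  have hmono := S.monotoneOn_branch_of_isFoldFree hfree
    (hcore ⟨le_rfl, by linarith⟩) (hcore ⟨by linarith, le_rfl⟩)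
  have hD : 0 < (4 / 3 : ℝ) ^ ((l : ℝ)⁻¹) := by positivity
  have hDl : ((4 / 3 : ℝ) ^ ((l : ℝ)⁻¹)) ^ l = 4 / 3 :=
    Real.rpow_inv_natCast_pow (by norm_num) hl
  have hcr : ∀ {a b c d}, a ∈ branchDomain l c₁ u T₁ → d ∈ branchDomain l c₁ u T₁ → a < b →
      b < c → c < d → crossRatio a b c d ≤ crossRatio (branch l c₁ s u a) (branch l c₁ s u b)
        (branch l c₁ s u c) (branch l c₁ s u d) := by
    intro a b c d ha hd hab hbc hcd
    have haff : ∀ {x y : ℝ}, x < y → c₁ + x * |u| ^ l < c₁ + y * |u| ^ l := fun hxy => by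
      nlinarith
    have := hfree.crossRatio_le hl S.even ha hd (Or.inl ⟨haff hab, haff hbc, haff hcd⟩)
    rw [crossRatio_affine hpos.ne'] at this
    unfold branch
    rwa [crossRatio_div S.periodic.ne_zero]
  -- every point of the line is `c₁ + y |u| ^ l` for some `y`
  have hcoord : ∀ x, c₁ + (x - c₁) / |u| ^ l * |u| ^ l = x := fun x => by
    rw [div_mul_cancel₀ _ hpos.ne']; ring
  refine ⟨hord, d0, d1, hmono, continuous_branch s u, S.branch_one, (neg_neg _).symm,
    by linarith [S.branch_zero_neg], by linarith [(abs_le.1 S.abs_branch_zero_le).1], hcr,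
    hD, hDl, ?_, ?_, S.branch_pow_nonneg⟩
  · obtain ⟨x, hx, hxc, hfar⟩ := S.exists_left_far hT₁
    have hmem : (x - c₁) / |u| ^ l ∈ branchDomain l c₁ u T₁ := by
      rw [branchDomain, mem_ofPred_eq, hcoord]; exact hx
    have hle : (x - c₁) / |u| ^ l ≤ 0 := div_nonpos_of_nonpos_of_nonneg (by linarith) hpos.le
    refine ⟨_, hmem, hle, ?_⟩
    have h1 := S.le_abs_branch (y := (x - c₁) / |u| ^ l) hD hDl (by rw [hcoord]; exact hfar)
    have h2 := hmono.monotoneOn hmem d0 hle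
    rw [abs_of_neg (by linarith [S.branch_zero_neg])] at h1
    linarith
  · obtain ⟨t, ht, hlt, m, hm, htm⟩ := S.exists_right_turning hT₁
    obtain ⟨x, hx, hfar⟩ := S.exists_far_of_turning (y := c₁ + |u| ^ l)
      ⟨by linarith, le_rfl⟩ hm htm
    rw [uIcc_of_le hlt.le] at hx
    have hτ : 1 < (t - c₁) / |u| ^ l := by rw [lt_div_iff₀ hpos]; linarith
    have hmem : (t - c₁) / |u| ^ l ∈ branchDomain l c₁ u T₁ := by
      rw [branchDomain, mem_ofPred_eq, hcoord]; exact ht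
    have hsub : Icc 0 ((t - c₁) / |u| ^ l) ⊆ branchDomain l c₁ u T₁ := hord.out d0 hmem
    refine ⟨_, hmem, hτ, ?_, fun y hy hyτ => S.lt_branch_pow hτ (hmono.mono hsub)
      (fun ha hd => hcr (hsub ha) (hsub hd)) (j := s - 1 - m) ?_ hy hyτ⟩
    · have hx1 : 1 ≤ (x - c₁) / |u| ^ l := by rw [le_div_iff₀ hpos]; linarith [hx.1]
      have hxτ : (x - c₁) / |u| ^ l ≤ (t - c₁) / |u| ^ l :=
        div_le_div_of_nonneg_right (by linarith [hx.2]) hpos.le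
      have hxm := hord.out d1 hmem ⟨hx1, hxτ⟩
      have h1 := S.le_abs_branch (y := (x - c₁) / |u| ^ l) hD hDl (by rw [hcoord]; exact hfar)
      have h2 := hmono.monotoneOn d1 hxm hx1
      rw [S.branch_one] at h2
      rw [abs_of_pos (by linarith)] at h1
      exact h1.trans (hmono.monotoneOn hxm hmem hxτ)
    · rw [branch, hcoord, ← htm, ← Function.iterate_add_apply]
      congr 3; omega

end IsDeepPeriodicInterval

/-! ### Numerical estimates -/

lemma mul_pow_mul_one_sub_le (hl : 4 ≤ l) {t : ℝ} (h0 : 0 ≤ t) (h1 : t ≤ 1) :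
    (l : ℝ) * (t ^ (l - 1) * (1 - t)) ≤ 27 / 64 := by
  -- The maximum over `t` is `(n / (n + 1)) ^ n` with `n = l - 1`, by Bernoulli's inequality.
  obtain ⟨n, rfl⟩ : ∃ n, l = n + 1 := ⟨l - 1, by omega⟩
  have hn3 : 3 ≤ n := by omega
  have hn : (3 : ℝ) ≤ n := by exact_mod_cast hn3
  have hn0 : (0 : ℝ) < n := by linarith
  rw [Nat.add_sub_cancel]
  push_cast
  set r : ℝ := 1 + 1 / n with hr
  have hr0 : 0 < r := by positivity
  have hmax : r ^ n * (((n : ℝ) + 1) * (t ^ n * (1 - t))) ≤ 1 := by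
    rcases h0.eq_or_lt with rfl | ht
    · rw [zero_pow (by omega)]; simp
    · set x := r * t with hx
      have hx0 : 0 < x := by positivity
      have hb := one_add_mul_le_pow (a := x⁻¹ - 1) (by have := inv_pos.2 hx0; linarith) (n + 1)
      rw [show 1 + (x⁻¹ - 1) = x⁻¹ by ring] at hb
      have := mul_le_mul_of_nonneg_left hb (pow_pos hx0 (n + 1)).le
      rw [← mul_pow, mul_inv_cancel₀ hx0.ne', one_pow] at this
      have e : x ^ (n + 1) * (1 + ((n + 1 : ℕ) : ℝ) * (x⁻¹ - 1)) =
          r ^ n * (((n : ℝ) + 1) * (t ^ n * (1 - t))) := by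
        have e1 : x ^ (n + 1) * (1 + ((n + 1 : ℕ) : ℝ) * (x⁻¹ - 1)) =
            x ^ n * ((n : ℝ) + 1 - n * x) := by
          push_cast; rw [pow_succ]; field_simp; ring
        rw [e1, hx, mul_pow, hr]
        field_simp
      rw [← e]; exact this
  have hrn : 64 / 27 ≤ r ^ n := by
    have hb := one_add_mul_self_le_rpow_one_add (s := 1 / (n : ℝ))
      (by have : (0 : ℝ) ≤ 1 / n := by positivity
          linarith) (p := n / 3) (by linarith)
    have e : (n : ℝ) / 3 * (1 / n) = 1 / 3 := by field_simp
    rw [e] at hb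
    have h3 := pow_le_pow_left₀ (by norm_num) hb 3
    rw [← Real.rpow_mul_natCast hr0.le,
      show (n : ℝ) / 3 * ((3 : ℕ) : ℝ) = n by push_cast; ring, Real.rpow_natCast] at h3
    refine le_trans ?_ h3
    norm_num
  have hy : 0 ≤ ((n : ℝ) + 1) * (t ^ n * (1 - t)) :=
    mul_nonneg (by linarith) (mul_nonneg (pow_nonneg h0 n) (by linarith))
  nlinarith

/-- If `(1 - k) ^ l ≥ 1 / B` and `A ^ l ≥ B` then `1 - 1 / A ≥ k`. -/
lemma one_le_mul_one_sub (hl : l ≠ 0) {A B k : ℝ} (hA : 0 < A) (hAB : B ≤ A ^ l) (hk : k ≤ 1)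
    (hB : 1 ≤ B * (1 - k) ^ l) : 1 ≤ A * (1 - k) := by
  have h1 : (1 : ℝ) ^ l ≤ (A * (1 - k)) ^ l := by
    rw [one_pow, mul_pow]
    exact hB.trans (mul_le_mul_of_nonneg_right hAB (pow_nonneg (by linarith) l))
  exact (pow_le_pow_iff_left₀ zero_le_one (mul_nonneg hA.le (by linarith)) hl).1 h1

lemma le_mul_sub_one_of_four_thirds_le (hl : 2 ≤ l) {A : ℝ} (hA : 0 < A) (hAl : 4 / 3 ≤ A ^ l) :
    A ≤ 4 * l * (A - 1) := by
  have hl' : (2 : ℝ) ≤ l := by exact_mod_cast hl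
  have hk : (1 : ℝ) / (4 * l) ≤ 1 := by rw [div_le_one (by linarith)]; linarith
  have := one_le_mul_one_sub (k := 1 / (4 * l)) (by omega) hA hAl hk (by
    have hb := one_add_mul_le_pow (a := -(1 / (4 * (l : ℝ)))) (by linarith) l
    have e : (l : ℝ) * -(1 / (4 * l)) = -(1 / 4) := by field_simp
    rw [e, ← sub_eq_add_neg 1 (1 / (4 * (l : ℝ)))] at hb
    linarith)
  have e : 4 * l * (A * (1 - 1 / (4 * (l : ℝ)))) = 4 * l * A - A := by field_simp
  nlinarith

lemma le_mul_sub_one_of_even (hl : 2 ≤ l) (he : Even l) {A : ℝ} (hA : 0 < A)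
    (hAl : 4 / 3 ≤ A ^ l) : 266 * A ≤ 1000 * l * (A - 1) := by
  obtain ⟨m, rfl⟩ := he
  have hm : (1 : ℝ) ≤ m := by exact_mod_cast (show 1 ≤ m by omega)
  have hm0 : (0 : ℝ) < m := by linarith
  push_cast
  have hk : (133 : ℝ) / (1000 * m) ≤ 1 := by rw [div_le_one (by linarith)]; linarith
  have := one_le_mul_one_sub (k := 133 / (1000 * m)) (by omega) hA hAl hk (by
    have hb := one_add_mul_le_pow (a := -(133 / (1000 * (m : ℝ)))) (by linarith) m
    have e : (m : ℝ) * -(133 / (1000 * m)) = -(133 / 1000) := by field_simp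
    rw [e, ← sub_eq_add_neg 1 (133 / (1000 * (m : ℝ)))] at hb
    rw [pow_add]
    nlinarith)
  have e : 1000 * m * (A * (1 - 133 / (1000 * (m : ℝ)))) = 1000 * m * A - 133 * A := by
    field_simp
  nlinarith

lemma le_mul_sub_one_of_eight_fifths_le (hl : 4 ≤ l) {A : ℝ} (hA : 0 < A)
    (hAl : 8 / 5 ≤ A ^ l) : 44 * A ≤ 100 * l * (A - 1) := by
  have hl' : (4 : ℝ) ≤ l := by exact_mod_cast hl
  have hl0 : (0 : ℝ) < l := by linarith
  have hk : (44 : ℝ) / (100 * l) ≤ 11 / 100 := by rw [div_le_div_iff₀] <;> linarith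
  have := one_le_mul_one_sub (k := 44 / (100 * l)) (by omega) hA hAl (by linarith) (by
    have hb := one_add_mul_self_le_rpow_one_add (s := -(44 / (100 * (l : ℝ))))
      (by linarith) (p := l / 4) (by linarith)
    have e : (l : ℝ) / 4 * -(44 / (100 * l)) = -(11 / 100) := by field_simp; norm_num
    rw [e] at hb
    have h4 := pow_le_pow_left₀ (by norm_num) hb 4
    rw [← Real.rpow_natCast _ 4, ← Real.rpow_natCast _ 4, ← Real.rpow_mul (by linarith),
      show (l : ℝ) / 4 * ((4 : ℕ) : ℝ) = l by push_cast; ring, Real.rpow_natCast,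
      ← sub_eq_add_neg 1 (44 / _)] at h4
    norm_num at h4 ⊢
    linarith)
  have e : 100 * l * (A * (1 - 44 / (100 * (l : ℝ)))) = 100 * l * A - 44 * A := by
    field_simp
  nlinarith

/-! ### The expansion at the periodic end point -/

namespace BranchBounds
variable {φ : ℝ → ℝ} {I : Set ℝ} {p D : ℝ}

lemma one_lt_D (B : BranchBounds l φ I p D) : 1 < D := by
  by_contra h
  have := pow_le_one₀ (n := l) B.D_pos.le (not_lt.1 h)
  rw [B.D_pow] at this
  norm_num at this

lemma D_le (B : BranchBounds l φ I p D) (hl : l ≠ 0) : D ≤ 4 / 3 := by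
  rw [← B.D_pow]; exact le_self_pow₀ B.one_lt_D.le hl

lemma one_add_le_D (B : BranchBounds l φ I p D) (hl : 2 ≤ l) : 1 + 1 / 4 / l ≤ D := by
  have hl' : (0 : ℝ) < l := by exact_mod_cast (show 0 < l by omega)
  have h1 := le_mul_sub_one_of_four_thirds_le hl B.D_pos B.D_pow.ge
  have h2 := B.one_lt_D
  have : 1 / 4 / (l : ℝ) ≤ D - 1 := by
    rw [div_le_iff₀ hl']; linarith
  linarith

/-- There is a point `v > 1` at which the first return map takes the value `1 + 1 / (1000 l)` and
exceeds `v` by a definite factor. Since `φ (z) = D` for some `z < 4 / 3`, the expansion of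
cross-ratios for the points `0, 1, v ^ l, z` bounds `v ^ l` from above. -/
lemma exists_expanding (B : BranchBounds l φ I p D) (hl : 2 ≤ l) (he : Even l) :
    ∃ v, 1 ≤ v ∧ v ^ l ∈ I ∧ φ (v ^ l) = 1 + 1 / 1000 / l ∧
      (1 + 1 / 100000 / (l : ℝ) ^ 2) * v ≤ 1 + 1 / 1000 / l := by
  have hl0 : l ≠ 0 := by omega
  have hl' : (2 : ℝ) ≤ l := by exact_mod_cast hl
  have hlpos : (0 : ℝ) < l := by linarith
  obtain ⟨τ, hτI, hτ, hDτ, hfix⟩ := B.right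
  have hD1 := B.one_lt_D
  have hsub : Icc 1 τ ⊆ I := B.ordConnected.out B.one_mem hτI
  obtain ⟨z, hz, hzD⟩ := intermediate_value_Icc hτ.le B.continuous.continuousOn
    (show D ∈ Icc (φ 1) (φ τ) from ⟨by rw [B.map_one]; exact hD1.le, hDτ⟩)
  have hz43 : z ≤ 4 / 3 := by
    by_contra hcon
    have hlt := not_le.1 hcon
    rw [← B.D_pow] at hlt
    have h1 := hfix D hD1 (hlt.le.trans hz.2)
    have h2 := B.strictMonoOn (hsub ⟨one_le_pow₀ hD1.le, hlt.le.trans hz.2⟩) (hsub hz) hlt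
    rw [hzD] at h2
    exact lt_irrefl _ (h1.trans h2)
  set δ : ℝ := 1 / 1000 / l with hδ
  have hδ0 : 0 < δ := by positivity
  have hδl : 1000 * l * δ = 1 := by rw [hδ]; field_simp
  have hDl := le_mul_sub_one_of_even hl he B.D_pos B.D_pow.ge
  have hδD : δ < D - 1 := by
    by_contra hcon
    nlinarith [mul_le_mul_of_nonneg_left (not_lt.1 hcon) (show (0 : ℝ) ≤ 1000 * l by linarith)]
  obtain ⟨y, hy, hyδ⟩ := intermediate_value_Icc hz.1 B.continuous.continuousOn
    (show 1 + δ ∈ Icc (φ 1) (φ z) from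
      ⟨by rw [B.map_one]; linarith, by rw [hzD]; linarith⟩)
  have hy1 : 1 < y := by
    refine lt_of_le_of_ne hy.1 ?_
    rintro rfl
    rw [B.map_one] at hyδ; linarith
  have hyz : y < z := by
    refine lt_of_le_of_ne hy.2 ?_
    rintro rfl
    rw [hzD] at hyδ; linarith
  have hcr := B.crossRatio_le B.zero_mem (hsub hz) one_pos hy1 hyz
  rw [B.map_zero, B.map_one, hyδ, hzD] at hcr
  unfold crossRatio at hcr
  have hp := B.pos
  rw [div_le_div_iff₀ (mul_pos (by linarith) (by linarith))
    (mul_pos (by linarith) (by linarith))] at hcr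
  -- the factor `(D + p) / (1 + p)` is at most `D`
  have h1 : (y - 1) * z * (D - 1 - δ) ≤ δ * D * (z - y) := by
    have hle : δ * (D + p) * (z - y) ≤ δ * (D * (1 + p)) * (z - y) := by
      refine mul_le_mul_of_nonneg_right (mul_le_mul_of_nonneg_left ?_ hδ0.le) (by linarith)
      nlinarith
    have : (1 + p) * ((y - 1) * z * (D - 1 - δ)) ≤ (1 + p) * (δ * D * (z - y)) := by
      linarith
    exact le_of_mul_le_mul_left this (by linarith)
  have hz0 : 0 < z := by linarith
  have h2 : 265 * D ≤ 1000 * l * (D - 1 - δ) := by linarith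
  have h3 : (y - 1) * z * 265 ≤ z - y := by
    have a1 : (y - 1) * z * (265 * D) ≤ (y - 1) * z * (1000 * l * (D - 1 - δ)) :=
      mul_le_mul_of_nonneg_left h2 (mul_nonneg (by linarith) hz0.le)
    have a2 : 1000 * l * ((y - 1) * z * (D - 1 - δ)) ≤ 1000 * l * (δ * D * (z - y)) :=
      mul_le_mul_of_nonneg_left h1 (by linarith)
    have a3 : 1000 * l * (δ * D * (z - y)) = D * (z - y) := by
      linear_combination D * (z - y) * hδl
    refine le_of_mul_le_mul_left ?_ B.D_pos
    linarith
  have h4 : y - 1 ≤ 945 / 1000000 := by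
    by_contra hcon
    have := mul_le_mul_of_nonneg_right (not_le.1 hcon).le hz0.le
    nlinarith [not_le.1 hcon]
  obtain ⟨v, hv0, hvy⟩ : ∃ v : ℝ, 0 ≤ v ∧ v ^ l = y :=
    ⟨y ^ ((l : ℝ)⁻¹), by positivity, Real.rpow_inv_natCast_pow (by linarith) hl0⟩
  have hv1 : 1 ≤ v := by
    rw [← one_le_pow_iff_of_nonneg hv0 hl0, hvy]; exact hy1.le
  refine ⟨v, hv1, by rw [hvy]; exact hsub ⟨hy1.le, hy.2.trans hz.2⟩, by rw [hvy, hyδ], ?_⟩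
  have hb := one_add_mul_le_pow (a := v - 1) (by linarith) l
  rw [show 1 + (v - 1) = v by ring, hvy] at hb
  set x : ℝ := 1 / l with hx
  have hxl : l * x = 1 := by rw [hx]; field_simp
  have hx0 : 0 < x := by positivity
  have hx2 : x ≤ 1 / 2 := by rw [hx, div_le_div_iff₀ hlpos two_pos]; linarith
  have hvx : v ≤ 1 + 945 / 1000000 * x := by
    have : l * (v - 1) ≤ l * (945 / 1000000 * x) := by
      have : l * (945 / 1000000 * x) = 945 / 1000000 * (l * x) := by ring
      rw [this, hxl]; linarith
    linarith [le_of_mul_le_mul_left this hlpos]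
  have e1 : 1 / 100000 / (l : ℝ) ^ 2 = 1 / 100000 * x ^ 2 := by rw [hx]; field_simp
  have e2 : δ = 1 / 1000 * x := by rw [hδ, hx]; field_simp
  rw [e1, e2]
  calc (1 + 1 / 100000 * x ^ 2) * v ≤ (1 + 1 / 100000 * x ^ 2) * (1 + 945 / 1000000 * x) :=
        mul_le_mul_of_nonneg_left hvx (by positivity)
    _ ≤ 1 + 1 / 1000 * x := by nlinarith [mul_pos hx0 hx0, mul_pos (mul_pos hx0 hx0) hx0]

end BranchBounds

/-! ### Points to the left of the critical value -/

namespace IsDeepPeriodicInterval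
variable {s : ℕ} {u : ℝ} {I : Set ℝ} {p D : ℝ}

/-- If `φ (-t) ∈ [-1, -t ^ l]`, the interval with ends `-t` and `1` generates a cycle outside `V`.
Points of `[-t, 0]` with an intermediate image in the interior of `V` are mapped by `φ` outside
`(-1, 1)`, hence to `-1`; since `φ` is injective and such points form an open set, there are
none. -/
lemma isTubeCycle_of_branch (S : IsDeepPeriodicInterval l c₁ s u)
    (B : BranchBounds l (branch l c₁ s u) I p D) {t : ℝ} (h0 : 0 < t) (h1 : t ≤ 1)
    (htI : -t ∈ I) (hle : branch l c₁ s u (-t) ≤ -t ^ l) (hge : -1 ≤ branch l c₁ s u (-t)) :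
    IsTubeCycle l c₁ |u| t s := by
  have hpos := S.pow_pos'
  refine S.isTubeCycle h0.le h1 (fun y hy n hn => ?_) hle (hle.trans_lt (neg_neg_of_pos
    (pow_pos h0 l)))
  by_contra hcon
  have hlt := not_le.1 hcon
  have hopen : IsOpen {x | |(powMap l c₁)^[n] x| < |u|} :=
    isOpen_lt (continuous_powMap_iterate n).abs continuous_const
  have hval : ∀ x ∈ Icc (c₁ - t * |u| ^ l) c₁, |(powMap l c₁)^[n] x| < |u| →
      branch l c₁ s u ((x - c₁) / |u| ^ l) = -1 := by
    intro x hx hxu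
    have hx1 : -t ≤ (x - c₁) / |u| ^ l := by rw [le_div_iff₀ hpos]; linarith [hx.1]
    have hx2 : (x - c₁) / |u| ^ l ≤ 0 := div_nonpos_of_nonpos_of_nonneg (by linarith [hx.2]) hpos.le
    have hxI := B.ordConnected.out htI B.zero_mem ⟨hx1, hx2⟩
    have m1 := B.strictMonoOn.monotoneOn htI hxI hx1
    have m2 := B.strictMonoOn.monotoneOn hxI B.zero_mem hx2
    rw [B.map_zero] at m2
    have hfar : |u| ≤ |(powMap l c₁)^[s - 1] x| := by
      have := S.periodic.abs_le_of_mem_image (i := s - 1 - n) (by omega) (by omega) hxu.le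
      rwa [← Function.iterate_add_apply, Nat.sub_add_cancel (by omega)] at this
    have hb : 1 ≤ |branch l c₁ s u ((x - c₁) / |u| ^ l)| := by
      rw [branch, div_mul_cancel₀ _ hpos.ne', add_sub_cancel, abs_div,
        le_div_iff₀ S.abs_pos', one_mul]
      exact hfar
    rw [abs_of_neg (by linarith [B.pos])] at hb
    linarith
  -- the set of such points is open in the interval, hence contains two points
  obtain ⟨x, hx, hxy, hxu⟩ : ∃ x ∈ Icc (c₁ - t * |u| ^ l) c₁, x ≠ y ∧
      |(powMap l c₁)^[n] x| < |u| := by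
    obtain ⟨ε, hε, hball⟩ := Metric.isOpen_iff.1 hopen y hlt
    have hlen : 0 < t * |u| ^ l := by positivity
    rcases le_or_gt y (c₁ - t * |u| ^ l / 2) with hmid | hmid
    · refine ⟨y + min (ε / 2) (t * |u| ^ l / 2), ⟨?_, ?_⟩, ?_, hball ?_⟩
      · linarith [hy.1, lt_min (half_pos hε) (half_pos hlen)]
      · linarith [min_le_right (ε / 2) (t * |u| ^ l / 2)]
      · exact ne_of_gt (by linarith [lt_min (half_pos hε) (half_pos hlen)])
      · rw [Metric.mem_ball, Real.dist_eq, add_sub_cancel_left,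
          abs_of_pos (lt_min (half_pos hε) (half_pos hlen))]
        linarith [min_le_left (ε / 2) (t * |u| ^ l / 2)]
    · refine ⟨y - min (ε / 2) (t * |u| ^ l / 2), ⟨?_, ?_⟩, ?_, hball ?_⟩
      · linarith [min_le_right (ε / 2) (t * |u| ^ l / 2)]
      · linarith [hy.2, lt_min (half_pos hε) (half_pos hlen)]
      · exact ne_of_lt (by linarith [lt_min (half_pos hε) (half_pos hlen)])
      · rw [Metric.mem_ball, Real.dist_eq, sub_sub_cancel_left, abs_neg,
          abs_of_pos (lt_min (half_pos hε) (half_pos hlen))]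
        linarith [min_le_left (ε / 2) (t * |u| ^ l / 2)]
  have mem : ∀ z ∈ Icc (c₁ - t * |u| ^ l) c₁, (z - c₁) / |u| ^ l ∈ I := fun z hz =>
    B.ordConnected.out htI B.zero_mem
      ⟨by rw [le_div_iff₀ hpos]; linarith [hz.1],
        div_nonpos_of_nonpos_of_nonneg (by linarith [hz.2]) hpos.le⟩
  have := B.strictMonoOn.injOn (mem x hx) (mem y hy) ((hval x hx hxu).trans (hval y hy hlt).symm)
  rw [div_left_inj' hpos.ne'] at this
  exact hxy (by linarith)

/-- The space `A` to the left of `V` provided by the smallest interval argument, and the expansion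
of cross-ratios along the whole cycle for the points `-t`, `0`, `p ^ l`. -/
lemma exists_space (S : IsDeepPeriodicInterval l c₁ s u)
    (B : BranchBounds l (branch l c₁ s u) I p D) {t : ℝ} (h0 : 0 < t) (h1 : t ≤ 1)
    (htI : -t ∈ I) (hle : branch l c₁ s u (-t) ≤ -t ^ l) (hge : -1 ≤ branch l c₁ s u (-t)) :
    ∃ A, 0 < A ∧ (4 + t) / 3 ≤ A ^ l ∧
      t * (A + branch l c₁ s u (-t)) ≤ p ^ (l - 1) * (-branch l c₁ s u (-t) - p) * A := by
  have H := S.isTubeCycle_of_branch B h0 h1 htI hle hge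
  have hl := S.exp_ne_zero
  have hpos := S.pow_pos'
  have hu := S.abs_pos'
  have hp := B.pos
  have hs := S.two_le
  obtain ⟨M, hMB, hesc⟩ := exists_escape_radius S.two_le_exp S.even c₁
    (max (2 * |u|) (|c₁ - t * |u| ^ l| + 1))
  rw [max_le_iff] at hMB
  have hd : c₁ + p ^ l * |u| ^ l ∈ tube l c₁ |u| t := by
    have := pow_le_one₀ (n := l) hp.le B.le_one
    have : 0 < p ^ l := pow_pos hp l
    exact ⟨by nlinarith, by nlinarith⟩
  have ha : -M < c₁ - t * |u| ^ l := by linarith [neg_abs_le (c₁ - t * |u| ^ l)]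
  have hb : c₁ - t * |u| ^ l < c₁ := by nlinarith
  have hc : c₁ < c₁ + p ^ l * |u| ^ l := by
    have : 0 < p ^ l * |u| ^ l := by positivity
    linarith
  obtain ⟨a, d, hPa, rfl, ho, hcr⟩ := H.exists_pushforward (n := s - 1)
    (H.isPropagated_isOuterPoint (M := M) (by linarith) hesc) (H.isPropagated_inner hd)
    (Or.inl (by rw [abs_neg]; exact le_abs_self M)) rfl H.left_mem H.center_mem
    (Or.inl ⟨ha, hb, hc⟩) (by omega)
  replace hcr := (div_le_crossRatio ha hb hc).trans hcr
  set q := branch l c₁ s u (p ^ l) with hq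
  have hq0 : 0 ≤ q := B.map_pow_nonneg
  set ρ := -branch l c₁ s u (-t) with hρ
  have eb : (powMap l c₁)^[s - 1] (c₁ - t * |u| ^ l) = -ρ * u := by
    have := S.iterate_eq_branch_mul (-t)
    rw [neg_mul, ← sub_eq_add_neg] at this
    rw [this, hρ, neg_neg]
  have ec : (powMap l c₁)^[s - 1] c₁ = -p * u := by
    have := S.iterate_eq_branch_mul 0
    rwa [zero_mul, add_zero, B.map_zero] at this
  have hρp : p < ρ := by
    have := B.strictMonoOn htI B.zero_mem (show -t < 0 by linarith)
    rw [B.map_zero] at this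
    linarith
  rw [eb, ec, S.iterate_eq_branch_mul, ← hq] at ho
  rw [eb, ec, S.iterate_eq_branch_mul, ← hq] at hcr
  set A := -(a / u) with hA
  have hu0 := S.periodic.ne_zero
  have eA : a = -A * u := by rw [hA, neg_neg, div_mul_cancel₀ _ hu0]
  have hAρ : ρ < A := by
    rw [eA] at ho
    rcases ho with ⟨o1, o2, -⟩ | ⟨-, o2, o3⟩
    · have hu1 : 0 < u := by
        by_contra hcon
        nlinarith [not_lt.1 hcon]
      nlinarith
    · have hu1 : u < 0 := by
        by_contra hcon
        nlinarith [not_lt.1 hcon]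
      nlinarith
  have hA0 : 0 < A := by linarith
  have habs : |a| = A * |u| := by rw [eA, abs_mul, abs_neg, abs_of_pos hA0]
  refine ⟨A, hA0, ?_, ?_⟩
  · rcases hPa with hM | ⟨b, hbs, hbn, w₀, hw₀, -, hsub⟩
    · have : 2 ≤ A := by
        rw [habs] at hM
        exact le_of_mul_le_mul_right (hMB.1.trans hM) hu
      have h2 : A ≤ A ^ l := le_self_pow₀ (by linarith) hl
      linarith
    · obtain ⟨w, hw, hfar⟩ := H.exists_end_le (n := b) (by omega)
      have hmem := hsub w (H.end_mem hw) c₁ H.center_mem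
      have hmax : |(powMap l c₁)^[b] w| ≤ A * |u| := by
        have := abs_le_max_abs_abs hmem.1 hmem.2
        rw [ec] at this
        refine this.trans ?_
        have e1 : |-p * u| = p * |u| := by rw [abs_mul, abs_neg, abs_of_pos hp]
        have e2 : p * |u| ≤ A * |u| := mul_le_mul_of_nonneg_right (by linarith) hu.le
        rcases le_total (-p * u) a with h | h
        · rw [inf_eq_left.2 h, sup_eq_right.2 h, e1, habs]
          exact max_le e2 le_rfl
        · rw [inf_eq_right.2 h, sup_eq_left.2 h, e1, habs]
          exact max_le le_rfl e2
      have := hfar.trans (pow_le_pow_left₀ (abs_nonneg _) hmax l)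
      rw [mul_pow] at this
      have := le_of_mul_le_mul_right this hpos
      linarith
  · have eq1 : crossRatio a (-ρ * u) (-p * u) (q * u) = crossRatio (-A) (-ρ) (-p) q := by
      have := crossRatio_affine hu0 0 (-A) (-ρ) (-p) q
      rw [eA]
      simpa using this
    have eq2 : (c₁ - (c₁ - t * |u| ^ l)) / (c₁ + p ^ l * |u| ^ l - c₁) = t / p ^ l := by
      rw [sub_sub_cancel, add_sub_cancel_left, mul_div_mul_right _ _ hpos.ne']
    rw [eq1, eq2] at hcr
    unfold crossRatio at hcr
    rw [div_le_div_iff₀ (pow_pos hp l) (mul_pos (by linarith) (by linarith))] at hcr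
    obtain ⟨k, rfl⟩ : ∃ k, l = k + 1 := ⟨l - 1, by omega⟩
    rw [Nat.add_sub_cancel]
    -- the worst case is `q = 0`
    have hqp : (q + A) * p ≤ A * (q + p) := by nlinarith
    have hk : 0 ≤ (ρ - p) * p ^ k := mul_nonneg (by linarith) (pow_nonneg hp.le k)
    have h5 := mul_le_mul_of_nonneg_left hqp hk
    refine le_of_mul_le_mul_left ?_ (show 0 < q + p by linarith)
    rw [pow_succ] at hcr
    nlinarith

/-- For `l ≥ 4` the branch takes values slightly beyond the end `-1` of `V` at points closer than
`1` to the critical value. -/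
lemma neg_one_lt_of_branch_eq (S : IsDeepPeriodicInterval l c₁ s u)
    (B : BranchBounds l (branch l c₁ s u) I p D) (hl4 : 4 ≤ l) {y : ℝ} (hyI : y ∈ I)
    (hy : branch l c₁ s u y = -(1 + 1 / 1000 / l)) : -1 < y := by
  set φ := branch l c₁ s u with hφ
  by_contra hcon
  have hy1 := not_lt.1 hcon
  have hl0 : l ≠ 0 := by omega
  have hl' : (4 : ℝ) ≤ l := by exact_mod_cast hl4
  have hlpos : (0 : ℝ) < l := by linarith
  have hp := B.pos
  have hI1 : (-1 : ℝ) ∈ I := B.ordConnected.out hyI B.zero_mem ⟨hy1, by norm_num⟩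
  have hsub : Icc (-1) 0 ⊆ I := B.ordConnected.out hI1 B.zero_mem
  set δ : ℝ := 1 / 1000 / l with hδ
  have hδ0 : 0 < δ := by positivity
  have hδl : 1000 * l * δ = 1 := by rw [hδ]; field_simp
  have hm1 : -(1 + δ) ≤ φ (-1) := by
    rw [← hy]; exact B.strictMonoOn.monotoneOn hyI hI1 hy1
  -- the bound for the space on the left when `t` is close to `1`
  have strong : ∀ t A : ℝ, 96 / 100 ≤ t → 0 < A → (4 + t) / 3 ≤ A ^ l →
      44 * A ≤ 100 * l * (A - 1) := fun t A ht hA h =>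
    le_mul_sub_one_of_eight_fifths_le hl4 hA (by linarith)
  rcases le_or_gt (φ (-1)) (-1) with hcase | hcase
  · obtain ⟨y', hy', hy'1⟩ := intermediate_value_Icc (show (-1 : ℝ) ≤ 0 by norm_num)
      B.continuous.continuousOn (show -1 ∈ Icc (φ (-1)) (φ 0) from
        ⟨hcase, by rw [B.map_zero]; linarith [B.le_one]⟩)
    obtain ⟨t, rfl⟩ : ∃ t, y' = -t := ⟨-y', by ring⟩
    have ht1 : t ≤ 1 := by linarith [hy'.1]
    have ht0 : 0 ≤ t := by linarith [hy'.2]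
    have ht : 96 / 100 ≤ t := by
      rcases ht1.eq_or_lt with rfl | hlt
      · norm_num
      · obtain ⟨x, hxI, hx0, hxD⟩ := B.left
        have hDδ : 1 / 4 / (l : ℝ) ≤ D - 1 := by
          linarith [B.one_add_le_D (by omega)]
        have e4 : 1 / 4 / (l : ℝ) = 250 * δ := by rw [hδ]; field_simp; norm_num
        have hD43 := B.D_le hl0
        obtain ⟨z, hz, hzD⟩ := intermediate_value_Icc hx0 B.continuous.continuousOn
          (show -D ∈ Icc (φ x) (φ 0) from
            ⟨hxD, by rw [B.map_zero]; linarith [B.le_one, B.one_lt_D]⟩)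
        have hzI := B.ordConnected.out hxI B.zero_mem hz
        have hz1 : z < -1 := by
          rw [← B.strictMonoOn.lt_iff_lt hzI hI1, hzD]; linarith
        have hcr := B.crossRatio_le hzI B.one_mem hz1 (show (-1 : ℝ) < -t by linarith)
          (show -t < 1 by linarith)
        rw [hzD, hy'1, B.map_one] at hcr
        set η := -φ (-1) with hη
        have eη : φ (-1) = -η := by rw [hη, neg_neg]
        rw [eη] at hcr hm1
        unfold crossRatio at hcr
        rw [div_le_div_iff₀ (mul_pos (by linarith) (by linarith))
          (mul_pos (by linarith) (by linarith))] at hcr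
        have hη1 : 1 ≤ η := by linarith
        have h1 : (1 - t) * (2 * (D - η)) ≤ (η - 1) * (1 + D) * (1 + t) := by
          have hz' : 0 < -1 - z := by linarith
          have : (-1 - z) * ((1 - t) * (2 * (D - η))) ≤
              (-1 - z) * ((η - 1) * (1 + D) * (1 + t)) := by
            have hn : 0 ≤ (1 - t) * (2 * (D - η)) :=
              mul_nonneg (by linarith) (by linarith)
            nlinarith
          exact le_of_mul_le_mul_left this hz'
        have h2 : (η - 1) * (1 + D) * (1 + t) ≤ δ * (7 / 3) * 2 := by
          have a1 : (η - 1) * (1 + D) ≤ δ * (7 / 3) :=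
            mul_le_mul (by linarith) (by linarith) (by linarith [B.D_pos]) hδ0.le
          exact mul_le_mul a1 (by linarith) (by linarith) (by positivity)
        have h3 : (1 - t) * (2 * (249 * δ)) ≤ (1 - t) * (2 * (D - η)) :=
          mul_le_mul_of_nonneg_left (by linarith) (by linarith)
        have h4 : δ * ((1 - t) * 498) ≤ δ * (14 / 3) := by linarith
        linarith [le_of_mul_le_mul_left h4 hδ0]
    have htl : t ^ l ≤ 1 := pow_le_one₀ ht0 ht1
    obtain ⟨A, hA0, hAl, hineq⟩ := S.exists_space B (by linarith) ht1
      (hsub hy') (by rw [← hφ, hy'1]; linarith) (by rw [← hφ, hy'1])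
    rw [← hφ, hy'1] at hineq
    have h1 := strong t A ht hA0 hAl
    have h2 := mul_pow_mul_one_sub_le hl4 hp.le B.le_one
    have h3 : (l : ℝ) * (p ^ (l - 1) * (- -1 - p) * A) ≤ 27 / 64 * A := by
      rw [neg_neg]
      nlinarith [mul_le_mul_of_nonneg_right h2 hA0.le]
    have h4 : t * (44 * A) ≤ t * (100 * l * (A - 1)) := mul_le_mul_of_nonneg_left h1 ht0
    have h5 : (l : ℝ) * (t * (A + -1)) ≤ 27 / 64 * A :=
      (mul_le_mul_of_nonneg_left hineq hlpos.le).trans h3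
    nlinarith
  · obtain ⟨t, ht, ht0⟩ := intermediate_value_Icc zero_le_one
      (f := fun t : ℝ => φ (-t) + t ^ l)
      ((B.continuous.comp continuous_neg).add (continuous_pow l)).continuousOn
      (show (0 : ℝ) ∈ Icc _ _ by
        refine ⟨?_, ?_⟩
        · simp only [neg_zero, B.map_zero, zero_pow hl0]; linarith
        · simp only [one_pow]; linarith)
    simp only at ht0
    have htpos : 0 < t := by
      refine lt_of_le_of_ne ht.1 ?_
      rintro rfl
      rw [neg_zero, B.map_zero, zero_pow hl0] at ht0; linarith
    have htI : -t ∈ I := hsub ⟨by linarith [ht.2], by linarith⟩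
    have hφt : φ (-t) = -t ^ l := by linarith
    have htl : t ^ l ≤ 1 := pow_le_one₀ ht.1 ht.2
    obtain ⟨A, hA0, hAl, hineq⟩ := S.exists_space B htpos ht.2 htI
      (by rw [← hφ, hφt]) (by rw [← hφ, hφt]; linarith)
    rw [← hφ, hφt, neg_neg] at hineq
    set ρ := t ^ l with hρ
    have hρ0 : 0 < ρ := pow_pos htpos l
    have hpρ : p ≤ ρ := by
      have := B.strictMonoOn.monotoneOn htI B.zero_mem (show -t ≤ 0 by linarith)
      rw [hφt, B.map_zero] at this; linarith
    -- the maximum of `p ^ (l - 1) * (ρ - p)` over `p` in `[0, ρ]`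
    have h2 : (l : ℝ) * (p ^ (l - 1) * (ρ - p)) ≤ 27 / 64 * ρ ^ l := by
      have h := mul_pow_mul_one_sub_le hl4 (t := p / ρ) (by positivity)
        (by rw [div_le_one hρ0]; exact hpρ)
      have e : (l : ℝ) * (p ^ (l - 1) * (ρ - p)) =
          (l : ℝ) * ((p / ρ) ^ (l - 1) * (1 - p / ρ)) * ρ ^ l := by
        obtain ⟨k, rfl⟩ : ∃ k, l = k + 1 := ⟨l - 1, by omega⟩
        rw [Nat.add_sub_cancel, div_pow, pow_succ ρ]
        field_simp
      rw [e]
      exact mul_le_mul_of_nonneg_right h (pow_nonneg hρ0.le l)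
    have h5 : (l : ℝ) * (t * (A - 1)) ≤ 27 / 64 * ρ ^ l * A := by
      have a1 : (l : ℝ) * (t * (A - 1)) ≤ l * (t * (A + -ρ)) :=
        mul_le_mul_of_nonneg_left (mul_le_mul_of_nonneg_left (by linarith) htpos.le) hlpos.le
      have a2 := mul_le_mul_of_nonneg_left hineq hlpos.le
      have a3 := mul_le_mul_of_nonneg_right h2 hA0.le
      linarith
    -- `ρ ^ l = t ^ (l ^ 2)` is small unless `t` is close to `1`
    have hρl : ρ ^ l ≤ t * t ^ 15 := by
      rw [hρ, ← pow_mul, ← pow_succ']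
      exact pow_le_pow_of_le_one ht.1 ht.2 (by nlinarith)
    rcases le_or_gt (96 / 100) t with h96 | h96
    · have h1 := strong t A h96 hA0 hAl
      have h15 : t ^ 15 ≤ 1 := pow_le_one₀ ht.1 ht.2
      have h6 : ρ ^ l ≤ t := by nlinarith
      have h4 : t * (44 * A) ≤ t * (100 * l * (A - 1)) := mul_le_mul_of_nonneg_left h1 ht.1
      have h7 : ρ ^ l * A ≤ t * A := mul_le_mul_of_nonneg_right h6 hA0.le
      nlinarith [mul_pos htpos hA0]
    · have h1 := le_mul_sub_one_of_four_thirds_le (by omega) hA0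
        (show 4 / 3 ≤ A ^ l by linarith)
      have h15 : t ^ 15 ≤ (96 / 100) ^ 15 := pow_le_pow_left₀ ht.1 h96.le 15
      have h16 : t * t ^ 15 ≤ t * (96 / 100) ^ 15 := mul_le_mul_of_nonneg_left h15 ht.1
      have h4 : t * A ≤ t * (4 * l * (A - 1)) := mul_le_mul_of_nonneg_left h1 ht.1
      have h7 : ρ ^ l * A ≤ t * (96 / 100) ^ 15 * A :=
        mul_le_mul_of_nonneg_right (hρl.trans h16) hA0.le
      have h8 := mul_pos htpos hA0
      norm_num at h7
      nlinarith

end IsDeepPeriodicInterval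

/-! ### The space around the periodic interval -/

/-- If an interval contains `[-D |u|, D |u|]` with `1 < D`, then the components of the complement
of `[-|u|, |u|]` in it have length at least `(D - 1) |u|`. -/
lemma ofReal_le_volume_connectedComponentIn {J : Set ℝ} (hJ : J.OrdConnected) {D u : ℝ}
    (hD : 1 < D) (hu : u ≠ 0) (h1 : -(D * |u|) ∈ J) (h2 : D * |u| ∈ J) {x : ℝ}
    (hx : x ∈ J \ symInterval u) :
    ENNReal.ofReal ((D - 1) * |u|) ≤
      MeasureTheory.volume (connectedComponentIn (J \ symInterval u) x) := by
  have hu0 := abs_pos.2 hu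
  have hDu : |u| < D * |u| := by nlinarith
  have hxV : x < -|u| ∨ |u| < x := by
    by_contra! h
    exact hx.2 h
  rcases hxV with hxu | hxu
  · have hsub : Ico (min x (-(D * |u|))) (-|u|) ⊆ connectedComponentIn (J \ symInterval u) x := by
      refine isPreconnected_Ico.subset_connectedComponentIn ⟨min_le_left _ _, hxu⟩ fun y hy => ?_
      refine ⟨hJ.out ?_ h2 ⟨hy.1, by linarith [hy.2]⟩, fun hyV => not_lt.2 hyV.1 hy.2⟩
      rcases min_choice x (-(D * |u|)) with h | h <;> rw [h]
      exacts [hx.1, h1]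
    refine le_trans ?_ (MeasureTheory.measure_mono hsub)
    rw [Real.volume_Ico]
    exact ENNReal.ofReal_le_ofReal (by linarith [min_le_right x (-(D * |u|))])
  · have hsub : Ioc |u| (max x (D * |u|)) ⊆ connectedComponentIn (J \ symInterval u) x := by
      refine isPreconnected_Ioc.subset_connectedComponentIn ⟨hxu, le_max_left _ _⟩ fun y hy => ?_
      refine ⟨hJ.out h1 ?_ ⟨by linarith [hy.1], hy.2⟩, fun hyV => not_lt.2 hyV.2 hy.1⟩
      rcases max_choice x (D * |u|) with h | h <;> rw [h]
      exacts [hx.1, h2]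
    refine le_trans ?_ (MeasureTheory.measure_mono hsub)
    rw [Real.volume_Ioc]
    exact ENNReal.ofReal_le_ofReal (by linarith [le_max_right x (D * |u|)])

lemma symInterval_subset_interior {J : Set ℝ} (hJ : J.OrdConnected) {D u : ℝ}
    (hD : 1 < D) (hu : u ≠ 0) (h1 : -(D * |u|) ∈ J) (h2 : D * |u| ∈ J) :
    symInterval u ⊆ interior J := by
  have hu0 := abs_pos.2 hu
  refine Subset.trans (fun y hy => ?_)
    (interior_maximal (Ioo_subset_Icc_self.trans (hJ.out h1 h2)) isOpen_Ioo)
  exact ⟨by nlinarith [hy.1], by nlinarith [hy.2]⟩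

namespace IsDeepPeriodicInterval
variable {s : ℕ} {u : ℝ} {T₁ : Set ℝ} {p D : ℝ}

/-- The image of the interval of monotonicity contains the rescaling of `V` by the factor `D`. -/
lemma mul_abs_mem_image (S : IsDeepPeriodicInterval l c₁ s u) (hT : T₁.OrdConnected)
    (B : BranchBounds l (branch l c₁ s u) (branchDomain l c₁ u T₁) p D) :
    ((powMap l c₁)^[s - 1] '' T₁).OrdConnected ∧
      -(D * |u|) ∈ (powMap l c₁)^[s - 1] '' T₁ ∧ D * |u| ∈ (powMap l c₁)^[s - 1] '' T₁ := by
  obtain ⟨x, hxI, hx0, hxD⟩ := B.left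
  obtain ⟨τ, hτI, hτ, hDτ, -⟩ := B.right
  have hord : ((powMap l c₁)^[s - 1] '' T₁).OrdConnected :=
    (hT.isPreconnected.image _ (continuous_powMap_iterate _).continuousOn).ordConnected
  have key : ∀ r, -D ≤ r → r ≤ D → r * u ∈ (powMap l c₁)^[s - 1] '' T₁ := by
    intro r h1 h2
    obtain ⟨y, hy, rfl⟩ := intermediate_value_Icc (show x ≤ τ by linarith)
      B.continuous.continuousOn (show r ∈ Icc _ _ from ⟨hxD.trans h1, h2.trans hDτ⟩)
    exact ⟨_, B.ordConnected.out hxI hτI hy, S.iterate_eq_branch_mul y⟩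
  have hD := B.D_pos
  refine ⟨hord, ?_⟩
  rcases abs_choice u with h | h <;> rw [h]
  · exact ⟨by rw [← neg_mul]; exact key _ le_rfl (by linarith), key _ (by linarith) le_rfl⟩
  · rw [mul_neg, neg_neg, ← neg_mul]
    exact ⟨key _ (by linarith) le_rfl, key _ le_rfl (by linarith)⟩

lemma mul_mem_sideComponent (S : IsDeepPeriodicInterval l c₁ s u)
    (B : BranchBounds l (branch l c₁ s u) (branchDomain l c₁ u T₁) p D) {v : ℝ} (hv : 1 ≤ v)
    (hvI : v ^ l ∈ branchDomain l c₁ u T₁) : v * u ∈ sideComponent (powMap l c₁) T₁ u := by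
  have hsub : (fun x => x * u) '' Icc 1 v ⊆ powMap l c₁ ⁻¹' T₁ \ {0} := by
    rintro _ ⟨x, hx, rfl⟩
    refine ⟨?_, mul_ne_zero (by linarith [hx.1]) S.periodic.ne_zero⟩
    rw [mem_preimage, powMap_mul S.even]
    exact B.ordConnected.out B.one_mem hvI
      ⟨one_le_pow₀ hx.1, pow_le_pow_left₀ (by linarith [hx.1]) hx.2 l⟩
  exact (isPreconnected_Icc.image _ (by fun_prop)).subset_connectedComponentIn
    ⟨1, ⟨le_rfl, hv⟩, one_mul u⟩ hsub ⟨v, ⟨hv, le_rfl⟩, rfl⟩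

end IsDeepPeriodicInterval

end RealUnicritical

theorem mainTheorem7 :
    ∃ C₀ C₁ C₂ : ℝ, 0 < C₀ ∧ 0 < C₁ ∧ 0 < C₂ ∧
      ∀ (ℓ : ℕ) (c₁ : ℝ) (s : ℕ) (u : ℝ) (T₁ : Set ℝ),
        2 ≤ ℓ → Even ℓ →
        RealUnicritical.InfinitelyRenormalizable (RealUnicritical.powMap ℓ c₁) →
        RealUnicritical.IsPeriodicInterval (RealUnicritical.powMap ℓ c₁) s u →
        (∀ p : ℕ, 2 * p = s → ¬ RealUnicritical.Renormalizable (RealUnicritical.powMap ℓ c₁) p) →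
        RealUnicritical.IsMaximalMonotoneInterval ((RealUnicritical.powMap ℓ c₁)^[s - 1])
          (RealUnicritical.powMap ℓ c₁ '' RealUnicritical.symInterval u) T₁ →
        (RealUnicritical.symInterval u ⊆ interior ((RealUnicritical.powMap ℓ c₁)^[s - 1] '' T₁) ∧
          ∀ x ∈ ((RealUnicritical.powMap ℓ c₁)^[s - 1] '' T₁) \ RealUnicritical.symInterval u,
            ENNReal.ofReal (C₀ / (ℓ : ℝ) * |u|) ≤
              MeasureTheory.volume
                (connectedComponentIn
                  (((RealUnicritical.powMap ℓ c₁)^[s - 1] '' T₁) \ RealUnicritical.symInterval u)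
                  x)) ∧
        ∃ u' ∈ RealUnicritical.sideComponent (RealUnicritical.powMap ℓ c₁) T₁ u,
          (C₁ / 2 / (ℓ : ℝ) * |u| ≤ |(RealUnicritical.powMap ℓ c₁)^[s] u' - u| ∧
            |(RealUnicritical.powMap ℓ c₁)^[s] u' - u| ≤ C₁ / (ℓ : ℝ) * |u|) ∧
          (1 + C₂ / (ℓ : ℝ) ^ 2) * |u'| ≤ |(RealUnicritical.powMap ℓ c₁)^[s] u'| ∧
          (4 ≤ ℓ →
            ∃ u_star ∈ T₁,
              (RealUnicritical.powMap ℓ c₁)^[s - 1] u_star =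
                -((RealUnicritical.powMap ℓ c₁)^[s] u') ∧
              |u_star - c₁| < |RealUnicritical.powMap ℓ c₁ u - c₁|) := by
  refine ⟨1 / 4, 1 / 1000, 1 / 100000, by norm_num, by norm_num, by norm_num, ?_⟩
  intro l c₁ s u T₁ hl he hinf hper _ hT₁
  have S : RealUnicritical.IsDeepPeriodicInterval l c₁ s u := ⟨hl, he, hinf, hper⟩
  have B := S.branchBounds hT₁
  set D : ℝ := (4 / 3 : ℝ) ^ ((l : ℝ)⁻¹)
  have hlpos : (0 : ℝ) < l := by exact_mod_cast (show 0 < l by omega)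
  have hu := S.abs_pos'
  have hDl := B.one_add_le_D hl
  obtain ⟨hord, h1, h2⟩ := S.mul_abs_mem_image hT₁.prop.1 B
  refine ⟨⟨RealUnicritical.symInterval_subset_interior hord B.one_lt_D hper.ne_zero h1 h2,
    fun x hx => le_trans (ENNReal.ofReal_le_ofReal ?_)
      (RealUnicritical.ofReal_le_volume_connectedComponentIn hord B.one_lt_D hper.ne_zero h1 h2
        hx)⟩, ?_⟩
  · exact mul_le_mul_of_nonneg_right (by linarith) hu.le
  obtain ⟨v, hv, hvI, hφ, hexp⟩ := B.exists_expanding hl he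
  have hδ : (0 : ℝ) < 1 / 1000 / l := by positivity
  have hfs : (RealUnicritical.powMap l c₁)^[s] (v * u) = (1 + 1 / 1000 / l) * u := by
    rw [RealUnicritical.branch_pow he S.two_le, div_eq_iff hper.ne_zero] at hφ
    exact hφ
  refine ⟨v * u, S.mul_mem_sideComponent B hv hvI, ⟨?_, ?_⟩, ?_, fun hl4 => ?_⟩
  · rw [hfs, add_mul, one_mul, add_sub_cancel_left, abs_mul, abs_of_pos hδ]
    refine mul_le_mul_of_nonneg_right ?_ hu.le
    exact div_le_div_of_nonneg_right (by norm_num) hlpos.le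
  · rw [hfs, add_mul, one_mul, add_sub_cancel_left, abs_mul, abs_of_pos hδ]
  · rw [hfs, abs_mul, abs_mul, abs_of_nonneg (by linarith : 0 ≤ v), ← mul_assoc,
      abs_of_pos (by linarith : 0 < 1 + 1 / 1000 / (l : ℝ))]
    exact mul_le_mul_of_nonneg_right hexp hu.le
  · obtain ⟨x, hxI, hx0, hxD⟩ := B.left
    have hle : 1 / 1000 / (l : ℝ) ≤ 1 / 4 / l := div_le_div_of_nonneg_right (by norm_num) hlpos.le
    obtain ⟨y, hy, hyφ⟩ := intermediate_value_Icc hx0 B.continuous.continuousOn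
      (show -(1 + 1 / 1000 / (l : ℝ)) ∈ Set.Icc _ _ from
        ⟨by linarith, by rw [B.map_zero]; linarith [B.le_one]⟩)
    have hyI := B.ordConnected.out hxI B.zero_mem hy
    have hy1 := S.neg_one_lt_of_branch_eq B hl4 hyI hyφ
    refine ⟨c₁ + y * |u| ^ l, hyI, ?_, ?_⟩
    · rw [S.iterate_eq_branch_mul, hyφ, hfs, neg_mul]
    · have := RealUnicritical.powMap_mul (c₁ := c₁) he 1 u
      rw [one_mul, one_pow, one_mul] at this
      rw [this, add_sub_cancel_left, add_sub_cancel_left, abs_mul, abs_of_pos S.pow_pos',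
        abs_of_nonpos hy.2]
      nlinarith [S.pow_pos']
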